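/- Let $M$ be the space of smooth loops $u=(u^1,\dots,u^n):S^1=\mathbb R/\mathbb Z\to\mathbb R^n$, and let $P_0=g\,\frac{d}{dx}$ with $g=(g^{ab})$ a constant, symmetric, invertible real $n\times n$ matrix. Loops $v$ (tangent vectors) and $\beta$ (one-forms) are paired by $\langle v,\beta\rangle=\int_0^1\sum_a v^a\beta_a\,dx$, and $*$ denotes the formal adjoint for this pairing. Call a function $f(u,u_x,u_{xx},\dots)$ homogeneous of degree $d$ if it is a polynomial in the $x$-derivatives of the $u^a$ with coefficients smooth functions of $u\in\mathbb R^n$, homogeneous of degree $d$ when the $i$-th derivatives of the $u^a$ are given degree $i$ (and $u^a$ degree $0$). Let $k\ge 0$ and let $$Q=A_0\frac{d^{k+1}}{dx^{k+1}}+A_1\frac{d^{k}}{dx^{k}}+\dots+A_{k+1}$$ be a matrix differential operator such that the entries of $A_l$ are homogeneous of degree $l$ for $l=0,\dots,k+1$. Suppose that $Q$ is skew-symmetric, $Q^*=-Q$, and that $Q$ is a cocycle of $P_0$, i.e. the Schouten bracket $[P_0,Q]$ vanishes. Here, for skew-symmetric $P$ and $Q$, $$2[P,Q](\alpha,\beta)=P'_u(\alpha;Q_u\beta)-P'_u(\beta;Q_u\alpha)+Q_u{P'_u}^{*}(\alpha;\beta)+Q'_u(\alpha;P_u\beta)-Q'_u(\beta;P_u\alpha)+P_u{Q'_u}^{*}(\alpha;\beta),$$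 where $Q'_u(\alpha;v)=\frac{d}{ds}Q_{u+sv}\alpha\big|_{s=0}$ and $\langle Q'_u(\alpha;v),\beta\rangle=\langle v,{Q'_u}^{*}(\alpha;\beta)\rangle$ for all $v$. Then the following hold. 1. With $C^a(u)=\int_0^1u^a\,dx$ and $\{C^a,C^b\}_Q=\langle Q\,dC^a,dC^b\rangle$, one has $\{C^a,C^b\}_Q=0$ on $M$ for all $a,b$. 2. $Q$ is a coboundary with a homogeneous potential: there is a vector field $\dot u^a=X^a(u,u_x,u_{xx},\dots)$ on $M$, with every $X^a$ homogeneous of degree $k$, such that $$Q=L_X(P_0)=-\left(X'_u\,P_0+P_0\,{X'_u}^{*}\right),$$ where $X'_u v=\frac{d}{ds}X(u+sv)\big|_{s=0}$. -/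

import Mathlib

open scoped ContDiff

noncomputable section

namespace HydroPoisson

/-- Smooth loops `u : S¹ → ℝⁿ`, with `S¹ = ℝ / ℤ`, written as `1`-periodic smooth functions
of `x : ℝ`. They are the points of `M`; tangent vectors and one-forms at a point of `M` are
loops as well. -/
def IsLoop {n : ℕ} (u : ℝ → Fin n → ℝ) : Prop :=
  ContDiff ℝ ∞ u ∧ Function.Periodic u 1

/-- The pairing `⟨v, β⟩ = ∫ v(x) · β(x) dx` over the circle of vector fields and one-forms. -/
def pairing {n : ℕ} (v β : ℝ → Fin n → ℝ) : ℝ :=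
  ∫ x in (0 : ℝ)..1, ∑ a, v x a * β x a

/-- Infinite jets: `j i a` is the value of the `i`-th derivative `u^a_i`, with `u^a_0 = u^a`. -/
abbrev Jet (n : ℕ) : Type := ℕ → Fin n → ℝ

/-- The jet of the loop `u` at `x`. -/
def jet {n : ℕ} (u : ℝ → Fin n → ℝ) (x : ℝ) : Jet n := fun i => iteratedDeriv i u x

/-- `f` is a homogeneous polynomial of degree `d` in the derivatives `u_x, u_xx, …`, where the
`i`-th derivatives have degree `i`, whose coefficients are smooth functions of `u`. A monomial is
encoded by its exponents `m`, the exponent of the `(i+1)`-st derivative of `u^a` being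
`m (i, a)`. -/
def IsHomDiffPoly {n : ℕ} (d : ℕ) (f : Jet n → ℝ) : Prop :=
  ∃ (S : Finset ((ℕ × Fin n) →₀ ℕ)) (c : ((ℕ × Fin n) →₀ ℕ) → (Fin n → ℝ) → ℝ),
    (∀ m ∈ S, m.sum (fun q e => e * (q.1 + 1)) = d) ∧
    (∀ m ∈ S, ContDiff ℝ ∞ (c m)) ∧
    ∀ j : Jet n, f j = ∑ m ∈ S, c m (j 0) * m.prod (fun q e => j (q.1 + 1) q.2 ^ e)

/-- A matrix differential operator `∑_{k ≤ order} A_k(u, u_x, …) dᵏ/dxᵏ`. -/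
structure DiffOp (n : ℕ) where
  /-- an upper bound for the order -/
  order : ℕ
  /-- the coefficient of `dᵏ/dxᵏ` -/
  coeff : ℕ → Matrix (Fin n) (Fin n) (Jet n → ℝ)

/-- The value `Q_u α`. -/
def DiffOp.act {n : ℕ} (Q : DiffOp n) (u α : ℝ → Fin n → ℝ) : ℝ → Fin n → ℝ :=
  fun x a => ∑ k ∈ Finset.range (Q.order + 1), ∑ b,
    Q.coeff k a b (jet u x) * iteratedDeriv k α x b

/-- The derivative `Q'_u(α; v) = d/ds (Q_{u + s v} α)` at `s = 0`. -/
def DiffOp.frechet {n : ℕ} (Q : DiffOp n) (u α v : ℝ → Fin n → ℝ) : ℝ → Fin n → ℝ :=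
  fun x => deriv (fun s : ℝ => Q.act (u + s • v) α x) 0

/-- `w` is the value at `β` of the adjoint of `L`: `⟨L v, β⟩ = ⟨v, w⟩` for all loops `v`. -/
def IsAdjointValue {n : ℕ} (L : (ℝ → Fin n → ℝ) → (ℝ → Fin n → ℝ))
    (β w : ℝ → Fin n → ℝ) : Prop :=
  IsLoop w ∧ ∀ v, IsLoop v → pairing (L v) β = pairing v w

open Classical in
/-- The adjoint `L* β`, defined by `⟨L v, β⟩ = ⟨v, L* β⟩` for all loops `v`. For a linear
differential operator `L` it exists by integration by parts; see `IsAdjointValue.unique` for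
uniqueness. -/
def adj {n : ℕ} (L : (ℝ → Fin n → ℝ) → (ℝ → Fin n → ℝ)) (β : ℝ → Fin n → ℝ) :
    ℝ → Fin n → ℝ :=
  if h : ∃ w, IsAdjointValue L β w then h.choose else 0

theorem IsAdjointValue.unique {n : ℕ} {L : (ℝ → Fin n → ℝ) → (ℝ → Fin n → ℝ)}
    {β w₁ w₂ : ℝ → Fin n → ℝ} (h₁ : IsAdjointValue L β w₁) (h₂ : IsAdjointValue L β w₂) :
    w₁ = w₂ := by
  have hc₁ := h₁.1.1.continuous
  have hc₂ := h₂.1.1.continuous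
  have hv : IsLoop (w₁ - w₂) := ⟨h₁.1.1.sub h₂.1.1, h₁.1.2.sub h₂.1.2⟩
  have hcf : Continuous fun x => ∑ a, (w₁ - w₂) x a * (w₁ - w₂) x a := by
    simp only [Pi.sub_apply]
    fun_prop
  have key : ∫ x in (0 : ℝ)..1, ∑ a, (w₁ - w₂) x a * (w₁ - w₂) x a = 0 := by
    have e := (h₁.2 _ hv).symm.trans (h₂.2 _ hv)
    unfold pairing at e
    have i₁ : IntervalIntegrable (fun x => ∑ a, (w₁ - w₂) x a * w₁ x a)
        MeasureTheory.volume 0 1 := by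
      apply Continuous.intervalIntegrable
      simp only [Pi.sub_apply]
      fun_prop
    have i₂ : IntervalIntegrable (fun x => ∑ a, (w₁ - w₂) x a * w₂ x a)
        MeasureTheory.volume 0 1 := by
      apply Continuous.intervalIntegrable
      simp only [Pi.sub_apply]
      fun_prop
    rw [← sub_eq_zero, ← intervalIntegral.integral_sub i₁ i₂] at e
    rw [← e]
    congr 1
    funext x
    rw [← Finset.sum_sub_distrib]
    refine Finset.sum_congr rfl fun a _ => ?_
    simp only [Pi.sub_apply]
    ring
  have hnn : ∀ x, 0 ≤ ∑ a, (w₁ - w₂) x a * (w₁ - w₂) x a :=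
    fun x => Finset.sum_nonneg fun a _ => mul_self_nonneg _
  have hz : ∀ x ∈ Set.Icc (0 : ℝ) 1, ∑ a, (w₁ - w₂) x a * (w₁ - w₂) x a = 0 := by
    intro x hx
    by_contra hne
    have hpos := intervalIntegral.integral_pos (a := (0 : ℝ)) (b := 1) one_pos hcf.continuousOn
      (fun y _ => hnn y) ⟨x, hx, lt_of_le_of_ne (hnn x) (Ne.symm hne)⟩
    exact hpos.ne' key
  funext x
  obtain ⟨y, hy, hxy⟩ := hv.2.exists_mem_Ico₀ one_pos x
  have h0 := hz y ⟨hy.1, hy.2.le⟩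
  rw [Finset.sum_eq_zero_iff_of_nonneg fun a _ => mul_self_nonneg _] at h0
  have h1 : (w₁ - w₂) x = 0 := by
    rw [hxy]
    funext a
    exact mul_self_eq_zero.mp (h0 a (Finset.mem_univ a))
  exact sub_eq_zero.mp h1

theorem IsAdjointValue.adj_eq {n : ℕ} {L : (ℝ → Fin n → ℝ) → (ℝ → Fin n → ℝ)}
    {β w : ℝ → Fin n → ℝ} (h : IsAdjointValue L β w) : adj L β = w := by
  have hex : ∃ w, IsAdjointValue L β w := ⟨w, h⟩
  unfold adj
  rw [dif_pos hex]
  exact hex.choose_spec.unique h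

/-- The operator `Q` is skew-symmetric, `Q* = -Q`, so that it represents a bivector. -/
def DiffOp.IsSkew {n : ℕ} (Q : DiffOp n) : Prop :=
  ∀ u α β : ℝ → Fin n → ℝ, IsLoop u → IsLoop α → IsLoop β →
    pairing (Q.act u α) β = -pairing α (Q.act u β)

/-- `Q = A_0 dᵈ/dxᵈ + A_1 dᵈ⁻¹/dxᵈ⁻¹ + ⋯ + A_d`, the entries of `A_l` being homogeneous of
degree `l`. -/
def DiffOp.IsHomogeneous {n : ℕ} (Q : DiffOp n) (d : ℕ) : Prop :=
  Q.order = d ∧ ∀ k l : ℕ, k + l = d → ∀ a b, IsHomDiffPoly l (Q.coeff k a b)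

/-- The operator form of the Schouten bracket `[P, Q](α, β)` of two bivectors at the point `u`.
For skew-symmetric `P` and `Q`, the pairing of `2 [P, Q](α, β)` with `γ` is the cyclic sum over
`(α, β, γ)` of `⟨α, P'(β; Qγ)⟩ + ⟨α, Q'(β; Pγ)⟩`. -/
def schouten {n : ℕ} (P Q : DiffOp n) (u α β : ℝ → Fin n → ℝ) : ℝ → Fin n → ℝ :=
  (1 / 2 : ℝ) •
    (P.frechet u α (Q.act u β) - P.frechet u β (Q.act u α) + Q.act u (adj (P.frechet u α) β)
      + Q.frechet u α (P.act u β) - Q.frechet u β (P.act u α) + P.act u (adj (Q.frechet u α) β))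

/-- `Q` is a `2`-cocycle: `[P, Q] = 0`. -/
def IsCocycle {n : ℕ} (P Q : DiffOp n) : Prop :=
  ∀ u α β : ℝ → Fin n → ℝ, IsLoop u → IsLoop α → IsLoop β → schouten P Q u α β = 0

/-- A local vector field `u̇^a = X^a(u, u_x, …)` on the loop space. -/
abbrev VField (n : ℕ) : Type := Fin n → Jet n → ℝ

/-- The value of the vector field at the loop `u`. -/
def VField.val {n : ℕ} (X : VField n) (u : ℝ → Fin n → ℝ) : ℝ → Fin n → ℝ :=
  fun x a => X a (jet u x)

/-- The derivative `X'_u v = d/ds X(u + s v)` at `s = 0`. -/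
def VField.frechet {n : ℕ} (X : VField n) (u v : ℝ → Fin n → ℝ) : ℝ → Fin n → ℝ :=
  fun x => deriv (fun s : ℝ => VField.val X (u + s • v) x) 0

/-- The operator form of the Lie derivative of a bivector,
`L_X(P) α = P'(α; X) - X' P α - P X'* α`, at the point `u`. -/
def lieDeriv {n : ℕ} (X : VField n) (P : DiffOp n) (u α : ℝ → Fin n → ℝ) : ℝ → Fin n → ℝ :=
  P.frechet u α (VField.val X u) - VField.frechet X u (P.act u α)
    - P.act u (adj (VField.frechet X u) α)

/-- `Q = L_X(P)`. -/
def IsPotential {n : ℕ} (P Q : DiffOp n) (X : VField n) : Prop :=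
  ∀ u α : ℝ → Fin n → ℝ, IsLoop u → IsLoop α → Q.act u α = lieDeriv X P u α

/-- The bivector `g d/dx` with constant matrix `g`. -/
def hydro {n : ℕ} (g : Matrix (Fin n) (Fin n) ℝ) : DiffOp n where
  order := 1
  coeff k a b := fun _ => if k = 1 then g a b else 0

/-- The functional `C^a(u) = ∫ u^a dx`. -/
def casimir {n : ℕ} (a : Fin n) (u : ℝ → Fin n → ℝ) : ℝ := ∫ x in (0 : ℝ)..1, u x a

/-- The differential `dC^a`, a constant loop; see `hasDerivAt_casimir`. -/
def dCasimir {n : ℕ} (a : Fin n) : ℝ → Fin n → ℝ := fun _ => Pi.single a 1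

theorem hasDerivAt_casimir {n : ℕ} (a : Fin n) {u v : ℝ → Fin n → ℝ} (hu : IsLoop u)
    (hv : IsLoop v) :
    HasDerivAt (fun s : ℝ => casimir a (u + s • v)) (pairing v (dCasimir a)) 0 := by
  have hcu := hu.1.continuous
  have hcv := hv.1.continuous
  have e : (fun s : ℝ => casimir a (u + s • v))
      = fun s : ℝ => casimir a u + s * pairing v (dCasimir a) := by
    funext s
    have h1 : pairing v (dCasimir a) = ∫ x in (0 : ℝ)..1, v x a := by
      simp [pairing, dCasimir, Pi.single_apply]
    rw [h1]
    unfold casimir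
    simp only [Pi.add_apply, Pi.smul_apply, smul_eq_mul]
    rw [intervalIntegral.integral_add, intervalIntegral.integral_const_mul]
    · exact Continuous.intervalIntegrable (by fun_prop) _ _
    · exact Continuous.intervalIntegrable (by fun_prop) _ _
  rw [e]
  simpa using ((hasDerivAt_id (0 : ℝ)).mul_const (pairing v (dCasimir a))).const_add (casimir a u)

/-- The bracket `{C^a, C^b}_Q = X^a(C^b) = ⟨Q dC^a, dC^b⟩` with `X^a = Q dC^a`, a functional
of the loop `u`. -/
def casimirBracket {n : ℕ} (Q : DiffOp n) (a b : Fin n) (u : ℝ → Fin n → ℝ) : ℝ :=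
  pairing (Q.act u (dCasimir a)) (dCasimir b)

end HydroPoisson

end

open Filter Topology MeasureTheory intervalIntegral

noncomputable section

namespace HydroPoisson

/-! ### Integrals depending smoothly on parameters -/

/-! Write `P = g d/dx`. On loops `u = g w_x` the loop `w` serves as a coordinate: a variation `β` of
`w` moves `u` by `Pβ`, and `Q` becomes the 2-form `ω_w(α, β) = ⟨Q_u α, β⟩` on the space of the `w`.
Since `P` has constant coefficients, `[P, Q] = 0` says that `ω` is closed (`IsCocycle.pairing_eq`),
and `Q = L_X(P)` says that `ω` is, up to sign, the differential of the 1-form `β ↦ ⟨X, β⟩`. The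
Poincaré lemma on rays `t w` gives the primitive `θ(β) = ∫ t ⟨Q_{tu} w, β⟩ dt`. The only obstacle is
locality in `u`: derivatives of `w` are local in `u`, but the coefficient `A_{k+1}` of order zero
multiplies `w` itself.

The Casimirs remove this obstacle. For a constant one-form `e_b` one has `P e_b = 0`, so closedness
makes `β ↦ ⟨Q e_b, β⟩` a closed 1-form in `w`. Hence `{C^a, C^b}_Q` does not change when `u` is
moved in the image of `P`, that is, with fixed mean; at constant loops it vanishes because `A_{k+1}`
has positive degree. This is part 1 (`casimirBracket_eq_zero`). Consequently the entries of
`A_{k+1}` have vanishing integral on every loop and are total derivatives of homogeneous functions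
(`totalDeriv_primitive`). Integrating by parts, the potential of the closed 1-form `∫ t ⟨Q_{tu} e_b,
·⟩ dt` becomes `∫ f_b(u) dx` with `f_b` local in `u` (the `compensator`).

Now put `G(w) = ∫ ∑ f_b w^b dx`. The 1-form `dG - θ` has the same differential as `-θ`, and the
terms with undifferentiated `w` cancel (`val_potential`), which leaves a vector field `X` local in
`u` and homogeneous of degree `k`. The identity `Q = L_X(P)` then holds on the image of `P`
(`act_eq_lieDeriv_hydroOp`). Both sides at `x` depend only on the germ of `u` at `x`, and every germ
of a loop occurs in the image of `P`, so it holds everywhere (`isPotential_potential`).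

Homogeneity is carried through as invariance under weighted dilations (`HomLocal`), which passes
easily through derivatives and averages along rays; `HomLocal.isHomDiffPoly` recovers polynomials at
the end. -/

theorem hasFDerivAt_integral_param {E G : Type} [NormedAddCommGroup E] [NormedSpace ℝ E]
    [FiniteDimensional ℝ E] [NormedAddCommGroup G] [NormedSpace ℝ G]
    {F : E × ℝ → G} (hF : ContDiff ℝ ∞ F) (y₀ : E) :
    HasFDerivAt (fun y => ∫ t in (0 : ℝ)..1, F (y, t))
      (∫ t in (0 : ℝ)..1, (fderiv ℝ F (y₀, t)).comp (ContinuousLinearMap.inl ℝ E ℝ)) y₀ := by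
  have hF' : Continuous fun p : E × ℝ =>
      (fderiv ℝ F p).comp (ContinuousLinearMap.inl ℝ E ℝ) :=
    (hF.continuous_fderiv (by simp)).clm_comp continuous_const
  obtain ⟨C, hC⟩ := ((isCompact_closedBall y₀ 1).prod
    (isCompact_Icc (a := (0 : ℝ)) (b := 1))).exists_bound_of_continuousOn hF'.continuousOn
  refine hasFDerivAt_integral_of_dominated_of_fderiv_le
    (F' := fun y t => (fderiv ℝ F (y, t)).comp (ContinuousLinearMap.inl ℝ E ℝ))
    (bound := fun _ => C) (Metric.closedBall_mem_nhds y₀ one_pos) ?_ ?_ ?_ ?_ ?_ ?_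
  · refine Eventually.of_forall fun y => ?_
    exact (hF.continuous.comp (by fun_prop : Continuous fun t : ℝ => (y, t))).aestronglyMeasurable
  · exact (hF.continuous.comp (by fun_prop : Continuous fun t : ℝ => (y₀, t))).intervalIntegrable _ _
  · exact (hF'.comp (by fun_prop : Continuous fun t : ℝ => (y₀, t))).aestronglyMeasurable
  · refine Eventually.of_forall fun t ht y hy => ?_
    rw [Set.uIoc_of_le zero_le_one] at ht
    exact hC (y, t) ⟨hy, ht.1.le, ht.2⟩
  · exact intervalIntegrable_const
  · refine Eventually.of_forall fun t _ y _ => ?_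
    exact ((hF.differentiable (by simp)) (y, t)).hasFDerivAt.comp y (hasFDerivAt_prodMk_left y t)

theorem contDiff_integral_param {E G : Type} [NormedAddCommGroup E] [NormedSpace ℝ E]
    [FiniteDimensional ℝ E] [NormedAddCommGroup G] [NormedSpace ℝ G]
    {F : E × ℝ → G} (hF : ContDiff ℝ ∞ F) :
    ContDiff ℝ ∞ fun y => ∫ t in (0 : ℝ)..1, F (y, t) := by
  refine contDiff_infty.2 fun m => ?_
  -- The derivative is again such an integral, but with values in a space of linear maps, so the
  -- target space has to vary in the induction.
  induction m generalizing G with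
  | zero =>
    exact contDiff_zero.2 (continuous_iff_continuousAt.2 fun y =>
      (hasFDerivAt_integral_param hF y).continuousAt)
  | succ m ih =>
    have hd : fderiv ℝ (fun y => ∫ t in (0 : ℝ)..1, F (y, t)) = fun y =>
        ∫ t in (0 : ℝ)..1, (fderiv ℝ F (y, t)).comp (ContinuousLinearMap.inl ℝ E ℝ) :=
      funext fun y => (hasFDerivAt_integral_param hF y).fderiv
    have h' : ContDiff ℝ ∞ fun p : E × ℝ =>
        (fderiv ℝ F p).comp (ContinuousLinearMap.inl ℝ E ℝ) :=
      (hF.fderiv_right (m := ∞) (by simp)).clm_comp contDiff_const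
    push_cast
    rw [contDiff_succ_iff_fderiv]
    refine ⟨fun y => (hasFDerivAt_integral_param hF y).differentiableAt, by simp, ?_⟩
    rw [hd]
    exact ih h'

theorem hasDerivAt_integral_param {Φ Φ' : ℝ → ℝ → ℝ}
    (hΦ : ContDiff ℝ ∞ fun p : ℝ × ℝ => Φ p.1 p.2) (s : ℝ)
    (h : ∀ x, HasDerivAt (fun s => Φ s x) (Φ' s x) s) :
    HasDerivAt (fun s => ∫ x in (0 : ℝ)..1, Φ s x) (∫ x in (0 : ℝ)..1, Φ' s x) s := by
  have h1 := (hasFDerivAt_integral_param hΦ s).hasDerivAt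
  have hc : Continuous fun t : ℝ => (fderiv ℝ (fun p : ℝ × ℝ => Φ p.1 p.2) (s, t)).comp
      (ContinuousLinearMap.inl ℝ ℝ ℝ) :=
    ((hΦ.continuous_fderiv (by simp)).comp
      (by fun_prop : Continuous fun t : ℝ => (s, t))).clm_comp continuous_const
  rw [ContinuousLinearMap.intervalIntegral_apply (hc.intervalIntegrable _ _)] at h1
  refine h1.congr_deriv (Eq.symm ?_)
  refine integral_congr fun x _ => ?_
  refine (h x).unique ?_
  exact (((hΦ.differentiable (by simp)) (s, x)).hasFDerivAt.comp s
    (hasFDerivAt_prodMk_left s x)).hasDerivAt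

/-! ### Scalar loops -/

/-- A smooth `1`-periodic real function. -/
def IsScalarLoop (a : ℝ → ℝ) : Prop := ContDiff ℝ ∞ a ∧ Function.Periodic a 1

theorem isLoop_iff {n : ℕ} {u : ℝ → Fin n → ℝ} :
    IsLoop u ↔ ∀ a, IsScalarLoop fun x => u x a := by
  constructor
  · exact fun h a => ⟨contDiff_pi.1 h.1 a, fun x => congrFun (h.2 x) a⟩
  · exact fun h => ⟨contDiff_pi.2 fun a => (h a).1, fun x => funext fun a => (h a).2 x⟩

namespace IsScalarLoop

variable {a b : ℝ → ℝ}

theorem continuous (h : IsScalarLoop a) : Continuous a := h.1.continuous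

theorem const (c : ℝ) : IsScalarLoop fun _ => c := ⟨contDiff_const, fun _ => rfl⟩

theorem mul (ha : IsScalarLoop a) (hb : IsScalarLoop b) : IsScalarLoop fun x => a x * b x :=
  ⟨ha.1.mul hb.1, fun x => by simp only [ha.2 x, hb.2 x]⟩

theorem sum {ι : Type*} {s : Finset ι} {f : ι → ℝ → ℝ} (h : ∀ i ∈ s, IsScalarLoop (f i)) :
    IsScalarLoop fun x => ∑ i ∈ s, f i x :=
  ⟨ContDiff.sum fun i hi => (h i hi).1, fun x => Finset.sum_congr rfl fun i hi => (h i hi).2 x⟩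

theorem deriv (h : IsScalarLoop a) : IsScalarLoop (deriv a) :=
  ⟨(contDiff_infty_iff_deriv.1 h.1).2, fun x => by
    rw [← deriv_comp_add_const, h.2.funext]⟩

theorem iteratedDeriv (h : IsScalarLoop a) (i : ℕ) : IsScalarLoop (iteratedDeriv i a) := by
  induction i with
  | zero => simpa using h
  | succ i ih => rw [iteratedDeriv_succ]; exact ih.deriv

theorem hasDerivAt (h : IsScalarLoop a) (x : ℝ) : HasDerivAt a (_root_.deriv a x) x :=
  (h.1.differentiable (by simp) x).hasDerivAt

theorem integral_deriv_mul (ha : IsScalarLoop a) (hb : IsScalarLoop b) :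
    ∫ x in (0 : ℝ)..1, _root_.deriv a x * b x = -∫ x in (0 : ℝ)..1, a x * _root_.deriv b x := by
  have h := integral_mul_deriv_eq_deriv_mul (a := 0) (b := 1) (fun x _ => ha.hasDerivAt x)
    (fun x _ => hb.hasDerivAt x) (ha.deriv.continuous.intervalIntegrable _ _)
    (hb.deriv.continuous.intervalIntegrable _ _)
  have e1 : a 1 = a 0 := by simpa using ha.2 0
  have e2 : b 1 = b 0 := by simpa using hb.2 0
  rw [e1, e2] at h
  linarith

theorem integral_mul_iteratedDeriv (ha : IsScalarLoop a) (hb : IsScalarLoop b) (i : ℕ) :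
    ∫ x in (0 : ℝ)..1, a x * _root_.iteratedDeriv i b x
      = ∫ x in (0 : ℝ)..1, b x * ((-1) ^ i * _root_.iteratedDeriv i a x) := by
  induction i generalizing a with
  | zero => simp [mul_comm]
  | succ i ih =>
    have h1 := ha.integral_deriv_mul (hb.iteratedDeriv i)
    rw [← iteratedDeriv_succ, ih ha.deriv, ← iteratedDeriv_succ'] at h1
    rw [eq_neg_iff_add_eq_zero, add_comm, ← eq_neg_iff_add_eq_zero] at h1
    rw [h1, ← intervalIntegral.integral_neg]
    refine integral_congr fun x _ => ?_
    ring

end IsScalarLoop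

theorem iteratedDeriv_apply_pi {n : ℕ} {u : ℝ → Fin n → ℝ} (hu : ContDiff ℝ ∞ u) (i : ℕ) (x : ℝ)
    (a : Fin n) : iteratedDeriv i u x a = iteratedDeriv i (fun x => u x a) x := by
  induction i generalizing x with
  | zero => simp
  | succ i ih =>
    have hd : DifferentiableAt ℝ (iteratedDeriv i u) x :=
      (hu.differentiable_iteratedDeriv i (by exact_mod_cast WithTop.coe_lt_top _)) x
    rw [iteratedDeriv_succ, iteratedDeriv_succ, deriv_pi fun b => differentiableAt_pi.1 hd b]
    simp only [ih]

namespace IsLoop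

variable {n : ℕ} {u v : ℝ → Fin n → ℝ}

theorem scalar (h : IsLoop u) (a : Fin n) : IsScalarLoop fun x => u x a := isLoop_iff.1 h a

theorem jet_scalar (h : IsLoop u) (i : ℕ) (a : Fin n) :
    IsScalarLoop fun x => jet u x i a := by
  have : (fun x => jet u x i a) = iteratedDeriv i fun x => u x a :=
    funext fun x => iteratedDeriv_apply_pi h.1 i x a
  rw [this]
  exact (h.scalar a).iteratedDeriv i

theorem add (hu : IsLoop u) (hv : IsLoop v) : IsLoop (u + v) :=
  ⟨hu.1.add hv.1, hu.2.add hv.2⟩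

theorem sub (hu : IsLoop u) (hv : IsLoop v) : IsLoop (u - v) :=
  ⟨hu.1.sub hv.1, hu.2.sub hv.2⟩

theorem smul (s : ℝ) (hu : IsLoop u) : IsLoop (s • u) :=
  isLoop_iff.2 fun a => (IsScalarLoop.const s).mul (hu.scalar a)

theorem const (c : Fin n → ℝ) : IsLoop fun _ : ℝ => c := ⟨contDiff_const, fun _ => rfl⟩

end IsLoop

theorem isLoop_dCasimir {n : ℕ} (a : Fin n) : IsLoop (dCasimir a) := IsLoop.const _

theorem jet_add_smul {n : ℕ} {u v : ℝ → Fin n → ℝ} (hu : ContDiff ℝ ∞ u) (hv : ContDiff ℝ ∞ v)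
    (s x : ℝ) : jet (u + s • v) x = jet u x + s • jet v x := by
  funext i
  have hi : ((i : ℕ∞ω)) ≤ ∞ := by exact_mod_cast le_top
  simp only [jet, Pi.add_apply, Pi.smul_apply]
  rw [iteratedDeriv_add (hu.of_le hi).contDiffAt
    (show ContDiffAt ℝ i (s • v) x from ((hv.of_le hi).const_smul s).contDiffAt),
    iteratedDeriv_const_smul_field]

theorem jet_smul {n : ℕ} (u : ℝ → Fin n → ℝ) (s x : ℝ) : jet (s • u) x = s • jet u x := by
  funext i
  simp only [jet, Pi.smul_apply]
  rw [iteratedDeriv_const_smul_field]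

theorem jet_const_succ {n : ℕ} (c : Fin n → ℝ) (x : ℝ) (i : ℕ) :
    jet (fun _ : ℝ => c) x (i + 1) = 0 := by
  simp [jet, iteratedDeriv_const]

/-! ### The pairing -/

section pairing

variable {n : ℕ} {v w β : ℝ → Fin n → ℝ}

theorem pairing_comm (v β : ℝ → Fin n → ℝ) : pairing v β = pairing β v := by
  simp only [pairing, mul_comm]

theorem intervalIntegrable_pairing (hv : IsLoop v) (hβ : IsLoop β) :
    IntervalIntegrable (fun x => ∑ a, v x a * β x a) volume 0 1 :=
  (IsScalarLoop.sum fun a _ => (hv.scalar a).mul (hβ.scalar a)).continuous.intervalIntegrable _ _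

theorem pairing_add_left (hv : IsLoop v) (hw : IsLoop w) (hβ : IsLoop β) :
    pairing (v + w) β = pairing v β + pairing w β := by
  unfold pairing
  rw [← intervalIntegral.integral_add (intervalIntegrable_pairing hv hβ)
    (intervalIntegrable_pairing hw hβ)]
  refine integral_congr fun x _ => ?_
  simp only [Pi.add_apply, add_mul, Finset.sum_add_distrib]

theorem pairing_smul_left (s : ℝ) (v β : ℝ → Fin n → ℝ) :
    pairing (s • v) β = s * pairing v β := by
  unfold pairing
  rw [← intervalIntegral.integral_const_mul]
  refine integral_congr fun x _ => ?_
  simp only [Pi.smul_apply, smul_eq_mul, Finset.mul_sum, mul_assoc]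

theorem pairing_sub_left (hv : IsLoop v) (hw : IsLoop w) (hβ : IsLoop β) :
    pairing (v - w) β = pairing v β - pairing w β := by
  have h := pairing_add_left hv (hw.smul (-1)) hβ
  rw [pairing_smul_left] at h
  rw [show v - w = v + (-1 : ℝ) • w by simp [sub_eq_add_neg], h]
  ring

theorem pairing_zero_left (β : ℝ → Fin n → ℝ) : pairing 0 β = 0 := by simp [pairing]

/-- Both loops are adjoint values of the identity at `v`, so uniqueness of adjoints applies. This
lets identities of loops be proved after pairing with a test loop. -/
theorem eq_of_pairing_eq (hv : IsLoop v) (hw : IsLoop w)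
    (h : ∀ β, IsLoop β → pairing v β = pairing w β) : v = w :=
  IsAdjointValue.unique (L := id) (β := v) ⟨hv, fun _ _ => rfl⟩
    ⟨hw, fun β hβ => by rw [id, pairing_comm, h β hβ, pairing_comm]⟩

end pairing

/-! ### Adjoints of differential operators along a loop -/

/-- The adjoint at `1` of the operator `v ↦ ∑ p_{i,c} v^c_i`. -/
def greenAdj {n : ℕ} (N : ℕ) (p : ℕ → Fin n → ℝ → ℝ) : ℝ → Fin n → ℝ :=
  fun x c => ∑ i ∈ Finset.range N, (-1) ^ i * iteratedDeriv i (p i c) x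

theorem isLoop_greenAdj {n N : ℕ} {p : ℕ → Fin n → ℝ → ℝ} (hp : ∀ i c, IsScalarLoop (p i c)) :
    IsLoop (greenAdj N p) :=
  isLoop_iff.2 fun c => IsScalarLoop.sum fun i _ =>
    (IsScalarLoop.const _).mul ((hp i c).iteratedDeriv i)

theorem integral_green {n N : ℕ} {p : ℕ → Fin n → ℝ → ℝ} (hp : ∀ i c, IsScalarLoop (p i c))
    {v : ℝ → Fin n → ℝ} (hv : IsLoop v) :
    ∫ x in (0 : ℝ)..1, ∑ i ∈ Finset.range N, ∑ c, p i c x * jet v x i c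
      = pairing v (greenAdj N p) := by
  unfold pairing greenAdj
  have e : ∀ x, ∑ c, v x c * ∑ i ∈ Finset.range N, (-1) ^ i * iteratedDeriv i (p i c) x
      = ∑ i ∈ Finset.range N, ∑ c, v x c * ((-1) ^ i * iteratedDeriv i (p i c) x) := by
    intro x
    simp only [Finset.mul_sum]
    rw [Finset.sum_comm]
  simp only [e]
  rw [intervalIntegral.integral_finsetSum, intervalIntegral.integral_finsetSum]
  · refine Finset.sum_congr rfl fun i _ => ?_
    rw [intervalIntegral.integral_finsetSum, intervalIntegral.integral_finsetSum]
    · refine Finset.sum_congr rfl fun c _ => ?_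
      simp only [jet, iteratedDeriv_apply_pi hv.1]
      exact (hp i c).integral_mul_iteratedDeriv (hv.scalar c) i
    · exact fun c _ => ((hv.scalar c).mul ((IsScalarLoop.const _).mul
        ((hp i c).iteratedDeriv i))).continuous.intervalIntegrable _ _
    · exact fun c _ => ((hp i c).mul (hv.jet_scalar i c)).continuous.intervalIntegrable _ _
  · exact fun i _ => (IsScalarLoop.sum fun c _ => (hv.scalar c).mul ((IsScalarLoop.const _).mul
        ((hp i c).iteratedDeriv i))).continuous.intervalIntegrable _ _
  · exact fun i _ => (IsScalarLoop.sum fun c _ =>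
      (hp i c).mul (hv.jet_scalar i c)).continuous.intervalIntegrable _ _

/-- Integration by parts gives the adjoint explicitly. Since `adj` is a choice with default value
`0`, an explicit adjoint value is what makes it usable. -/
theorem isAdjointValue_green {n N : ℕ} {L : (ℝ → Fin n → ℝ) → ℝ → Fin n → ℝ}
    {p : Fin n → ℕ → Fin n → ℝ → ℝ} (hp : ∀ a i c, IsScalarLoop (p a i c))
    (hL : ∀ v, IsLoop v → ∀ x a, L v x a = ∑ i ∈ Finset.range N, ∑ c, p a i c x * jet v x i c)
    {β : ℝ → Fin n → ℝ} (hβ : IsLoop β) :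
    IsAdjointValue L β (greenAdj N fun i c x => ∑ a, p a i c x * β x a) := by
  have hq : ∀ i c, IsScalarLoop fun x => ∑ a, p a i c x * β x a := fun i c =>
    IsScalarLoop.sum fun a _ => (hp a i c).mul (hβ.scalar a)
  refine ⟨isLoop_greenAdj hq, fun v hv => ?_⟩
  rw [← integral_green hq hv]
  refine integral_congr fun x _ => ?_
  simp only [hL v hv, Finset.sum_mul]
  rw [Finset.sum_comm]
  refine Finset.sum_congr rfl fun i _ => ?_
  rw [Finset.sum_comm]
  refine Finset.sum_congr rfl fun c _ => ?_
  refine Finset.sum_congr rfl fun a _ => ?_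
  ring

/-! ### Loops with prescribed germs, and primitives -/

/-- The function is `arcsin (sin 2πy) / 2π`, with a cutoff in the variable `sin 2πy` that removes
the singularities of `arcsin` at `±1`. -/
theorem exists_scalarLoop_eq_id : ∃ h : ℝ → ℝ, IsScalarLoop h ∧ ∀ᶠ y in 𝓝 0, h y = y := by
  let ψ : ContDiffBump (0 : ℝ) := ⟨1 / 4, 1 / 2, by norm_num, by norm_num⟩
  have hφ : ContDiff ℝ ∞ fun s : ℝ => ψ s * Real.arcsin s := by
    rw [contDiff_iff_contDiffAt]
    intro s
    by_cases hs : s ∈ Metric.closedBall (0 : ℝ) (1 / 2)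
    · have hs' : |s| ≤ 1 / 2 := by simpa using hs
      refine ψ.contDiffAt.mul (Real.contDiffAt_arcsin ?_ ?_)
      · rintro rfl; norm_num at hs'
      · rintro rfl; norm_num at hs'
    · refine (contDiffAt_const (c := (0 : ℝ))).congr_of_eventuallyEq ?_
      filter_upwards [Metric.isClosed_closedBall.isOpen_compl.mem_nhds hs] with t ht
      have : ψ t = 0 := ψ.zero_of_le_dist (by
        simp only [Set.mem_compl_iff, Metric.mem_closedBall, not_le] at ht
        exact ht.le)
      simp [this]
  have hsin : ContDiff ℝ ∞ fun y : ℝ => Real.sin (2 * Real.pi * y) :=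
    Real.contDiff_sin.comp (contDiff_const.mul contDiff_id)
  refine ⟨fun y => (2 * Real.pi)⁻¹ *
    (ψ (Real.sin (2 * Real.pi * y)) * Real.arcsin (Real.sin (2 * Real.pi * y))), ⟨?_, ?_⟩, ?_⟩
  · exact contDiff_const.mul (hφ.comp hsin)
  · intro y
    have : Real.sin (2 * Real.pi * (y + 1)) = Real.sin (2 * Real.pi * y) := by
      rw [mul_add, mul_one, Real.sin_add_two_pi]
    simp only [this]
  · have h1 : ∀ᶠ y : ℝ in 𝓝 0, ψ (Real.sin (2 * Real.pi * y)) = 1 := by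
      have : Tendsto (fun y : ℝ => Real.sin (2 * Real.pi * y)) (𝓝 0) (𝓝 0) := by
        simpa using hsin.continuous.tendsto 0
      exact this.eventually ψ.eventuallyEq_one
    have h2 : ∀ᶠ y : ℝ in 𝓝 0, y ∈ Set.Ioo (-(1 / 4) : ℝ) (1 / 4) :=
      Ioo_mem_nhds (by norm_num) (by norm_num)
    filter_upwards [h1, h2] with y hy1 hy2
    have hpi := Real.pi_pos
    rw [hy1, Real.arcsin_sin (by nlinarith [hy2.1]) (by nlinarith [hy2.2])]
    field_simp

/-- Precomposing `f` with a periodic function that is the identity near the base point makes it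
periodic without changing its germ. -/
theorem exists_isLoop_eventuallyEq {n : ℕ} {f : ℝ → Fin n → ℝ} (hf : ContDiff ℝ ∞ f) (x₀ : ℝ) :
    ∃ w, IsLoop w ∧ w =ᶠ[𝓝 x₀] f := by
  obtain ⟨h, hh, hid⟩ := exists_scalarLoop_eq_id
  refine ⟨fun x => f (x₀ + h (x - x₀)), ⟨?_, ?_⟩, ?_⟩
  · exact hf.comp (contDiff_const.add (hh.1.comp (contDiff_id.sub contDiff_const)))
  · intro x
    have : h (x + 1 - x₀) = h (x - x₀) := by
      rw [show x + 1 - x₀ = x - x₀ + 1 by ring, hh.2]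
    simp only [this]
  · have ht : Tendsto (fun x : ℝ => x - x₀) (𝓝 x₀) (𝓝 0) := by
      have : Continuous fun x : ℝ => x - x₀ := by fun_prop
      simpa using this.tendsto x₀
    filter_upwards [ht.eventually hid] with x hx
    rw [hx]
    congr 1
    ring

theorem exists_contDiff_primitive {f : ℝ → ℝ} (hf : ContDiff ℝ ∞ f) :
    ContDiff ℝ ∞ (fun x => ∫ t in (0 : ℝ)..x, f t) ∧
      ∀ x, HasDerivAt (fun x => ∫ t in (0 : ℝ)..x, f t) (f x) x := by
  have hd : ∀ x, HasDerivAt (fun x => ∫ t in (0 : ℝ)..x, f t) (f x) x := fun x =>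
    integral_hasDerivAt_right (hf.continuous.intervalIntegrable _ _)
      (hf.continuous.stronglyMeasurableAtFilter _ _) hf.continuous.continuousAt
  refine ⟨contDiff_infty_iff_deriv.2 ⟨fun x => (hd x).differentiableAt, ?_⟩, hd⟩
  rwa [show deriv (fun x => ∫ t in (0 : ℝ)..x, f t) = f from funext fun x => (hd x).deriv]

theorem exists_scalarLoop_deriv_eq {f : ℝ → ℝ} (hf : IsScalarLoop f)
    (h0 : ∫ x in (0 : ℝ)..1, f x = 0) : ∃ w, IsScalarLoop w ∧ deriv w = f := by
  obtain ⟨h1, h2⟩ := exists_contDiff_primitive hf.1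
  refine ⟨fun x => ∫ t in (0 : ℝ)..x, f t, ⟨h1, fun x => ?_⟩, funext fun x => (h2 x).deriv⟩
  simp only
  rw [← integral_add_adjacent_intervals (hf.continuous.intervalIntegrable 0 x)
    (hf.continuous.intervalIntegrable x (x + 1)), hf.2.intervalIntegral_add_eq x 0]
  simp [h0]

/-! ### Smooth functions of finitely many jet coordinates -/

/-- The first `N` components of a jet. -/
def Jet.trunc {n : ℕ} (N : ℕ) (j : Jet n) : Fin N → Fin n → ℝ := fun i => j i

/-- `f` is a smooth function of finitely many jet coordinates. -/
def IsSmoothLocal {n : ℕ} (f : Jet n → ℝ) : Prop :=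
  ∃ (N : ℕ) (F : (Fin N → Fin n → ℝ) → ℝ), ContDiff ℝ ∞ F ∧ ∀ j, f j = F (j.trunc N)

/-- The directional derivative of `f` at `j` along `v`. -/
def dir {n : ℕ} (f : Jet n → ℝ) (j v : Jet n) : ℝ := deriv (fun s : ℝ => f (j + s • v)) 0

/-- The jet with the single nonzero coordinate `u^c_i = 1`. -/
def unitJet {n : ℕ} (i : ℕ) (c : Fin n) : Jet n := Pi.single i (Pi.single c 1)

/-- The partial derivative `∂f / ∂u^c_i`. -/
def part {n : ℕ} (f : Jet n → ℝ) (i : ℕ) (c : Fin n) (j : Jet n) : ℝ := dir f j (unitJet i c)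

/-- The jet of `u_x`. -/
def shift {n : ℕ} (j : Jet n) : Jet n := fun i => j (i + 1)

/-- The total `x`-derivative of a function of jets. -/
def totalDeriv {n : ℕ} (f : Jet n → ℝ) (j : Jet n) : ℝ := dir f j (shift j)

variable {n : ℕ}

theorem sum_smul_unitJet_trunc (N : ℕ) (v : Jet n) :
    v.trunc N = ∑ i ∈ Finset.range N, ∑ c, v i c • (unitJet i c).trunc N := by
  funext i c
  simp only [Jet.trunc, unitJet, Finset.sum_apply, Pi.smul_apply, smul_eq_mul]
  rw [Finset.sum_eq_single (i : ℕ)]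
  · rw [Finset.sum_eq_single c]
    · simp
    · intro b _ hb
      simp [Pi.single_eq_of_ne' hb]
    · simp
  · intro k _ hk
    simp [Pi.single_eq_of_ne' hk]
  · simp

namespace IsSmoothLocal

variable {f h : Jet n → ℝ}

theorem exists_of_le {N M : ℕ} {F : (Fin N → Fin n → ℝ) → ℝ} (hF : ContDiff ℝ ∞ F)
    (hf : ∀ j : Jet n, f j = F (j.trunc N)) (hNM : N ≤ M) :
    ∃ G : (Fin M → Fin n → ℝ) → ℝ, ContDiff ℝ ∞ G ∧ ∀ j : Jet n, f j = G (j.trunc M) :=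
  ⟨fun y => F fun i => y (Fin.castLE hNM i), hF.comp (by fun_prop), hf⟩

theorem contDiff_comp {E : Type*} [NormedAddCommGroup E] [NormedSpace ℝ E] (hf : IsSmoothLocal f)
    {γ : E → Jet n} (hγ : ∀ i a, ContDiff ℝ ∞ fun e => γ e i a) :
    ContDiff ℝ ∞ fun e => f (γ e) := by
  obtain ⟨N, F, hF, h⟩ := hf
  simp only [h]
  exact hF.comp (contDiff_pi.2 fun i => contDiff_pi.2 fun a => hγ i a)

theorem op₂ (hf : IsSmoothLocal f) (hh : IsSmoothLocal h) {m : ℝ → ℝ → ℝ}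
    (hm : ContDiff ℝ ∞ fun p : ℝ × ℝ => m p.1 p.2) : IsSmoothLocal fun j => m (f j) (h j) := by
  obtain ⟨N, F, hF, hf⟩ := hf
  obtain ⟨M, H, hH, hh⟩ := hh
  obtain ⟨F', hF', hf'⟩ := exists_of_le hF hf (le_max_left N M)
  obtain ⟨H', hH', hh'⟩ := exists_of_le hH hh (le_max_right N M)
  exact ⟨_, fun y => m (F' y) (H' y), hm.comp (hF'.prodMk hH'), fun j => by simp only [hf', hh']⟩

theorem add (hf : IsSmoothLocal f) (hh : IsSmoothLocal h) : IsSmoothLocal fun j => f j + h j :=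
  hf.op₂ hh (m := fun a b => a + b) contDiff_add

theorem mul (hf : IsSmoothLocal f) (hh : IsSmoothLocal h) : IsSmoothLocal fun j => f j * h j :=
  hf.op₂ hh (m := fun a b => a * b) contDiff_mul

theorem const (c : ℝ) : IsSmoothLocal fun _ : Jet n => c :=
  ⟨0, fun _ => c, contDiff_const, fun _ => rfl⟩

theorem sum {ι : Type*} {s : Finset ι} {f : ι → Jet n → ℝ} (h : ∀ i ∈ s, IsSmoothLocal (f i)) :
    IsSmoothLocal fun j => ∑ i ∈ s, f i j := by
  classical
  induction s using Finset.induction_on with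
  | empty => simpa using const 0
  | insert a s ha ih =>
    simp only [Finset.sum_insert ha]
    exact (h a (by simp)).add (ih fun i hi => h i (by simp [hi]))

theorem coord (i : ℕ) (a : Fin n) : IsSmoothLocal fun j : Jet n => j i a :=
  ⟨i + 1, fun y => y (Fin.last i) a, by fun_prop, fun _ => rfl⟩

theorem comp_smul (hf : IsSmoothLocal f) (t : ℝ) : IsSmoothLocal fun j => f (t • j) := by
  obtain ⟨N, F, hF, h⟩ := hf
  exact ⟨N, fun y => F (t • y), hF.comp (by fun_prop), fun j => h _⟩

theorem hasDerivAt_aux {N : ℕ} {F : (Fin N → Fin n → ℝ) → ℝ} (hF : ContDiff ℝ ∞ F)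
    (h : ∀ j : Jet n, f j = F (j.trunc N)) (j v : Jet n) (s : ℝ) :
    HasDerivAt (fun s : ℝ => f (j + s • v)) (fderiv ℝ F ((j + s • v).trunc N) (v.trunc N)) s := by
  simp only [h]
  have h1 : HasDerivAt (fun s : ℝ => (j + s • v).trunc N) (v.trunc N) s := by
    have := ((hasDerivAt_id s).smul_const (v.trunc N)).const_add (j.trunc N)
    rw [one_smul] at this
    exact this
  exact ((hF.differentiable (by simp)) _).hasFDerivAt.comp_hasDerivAt s h1

theorem dir_aux {N : ℕ} {F : (Fin N → Fin n → ℝ) → ℝ} (hF : ContDiff ℝ ∞ F)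
    (h : ∀ j : Jet n, f j = F (j.trunc N)) (j v : Jet n) :
    dir f j v = fderiv ℝ F (j.trunc N) (v.trunc N) := by
  have := (hasDerivAt_aux hF h j v 0).deriv
  simpa [dir] using this

theorem hasDerivAt (hf : IsSmoothLocal f) (j v : Jet n) (s : ℝ) :
    HasDerivAt (fun s : ℝ => f (j + s • v)) (dir f (j + s • v) v) s := by
  obtain ⟨N, F, hF, h⟩ := hf
  rw [dir_aux hF h]
  exact hasDerivAt_aux hF h j v s

theorem hasDerivAt_zero (hf : IsSmoothLocal f) (j v : Jet n) :
    HasDerivAt (fun s : ℝ => f (j + s • v)) (dir f j v) 0 := by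
  simpa using hf.hasDerivAt j v 0

theorem dir_smul (hf : IsSmoothLocal f) (j v : Jet n) (c : ℝ) :
    dir f j (c • v) = c * dir f j v := by
  obtain ⟨N, F, hF, h⟩ := hf
  rw [dir_aux hF h, dir_aux hF h, show (c • v).trunc N = c • v.trunc N from rfl, map_smul,
    smul_eq_mul]

theorem exists_dir_eq_sum (hf : IsSmoothLocal f) : ∃ N, ∀ j v,
    dir f j v = ∑ i ∈ Finset.range N, ∑ c, part f i c j * v i c := by
  obtain ⟨N, F, hF, h⟩ := hf
  refine ⟨N, fun j v => ?_⟩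
  rw [dir_aux hF h, sum_smul_unitJet_trunc N v, map_sum]
  refine Finset.sum_congr rfl fun i _ => ?_
  rw [map_sum]
  refine Finset.sum_congr rfl fun c _ => ?_
  rw [map_smul, part, dir_aux hF h, smul_eq_mul, mul_comm]

theorem part (hf : IsSmoothLocal f) (i : ℕ) (c : Fin n) : IsSmoothLocal (part f i c) := by
  obtain ⟨N, F, hF, h⟩ := hf
  refine ⟨N, fun y => fderiv ℝ F y ((unitJet i c).trunc N), ?_, fun j => dir_aux hF h j _⟩
  exact (hF.fderiv_right (m := ∞) (by simp)).clm_apply contDiff_const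

theorem dir (hf : IsSmoothLocal f) {V : Jet n → Jet n} (hV : ∀ i a, IsSmoothLocal fun j => V j i a) :
    IsSmoothLocal fun j => dir f j (V j) := by
  obtain ⟨N, h⟩ := hf.exists_dir_eq_sum
  simp only [h]
  exact sum fun i _ => sum fun c _ => (hf.part i c).mul (hV i c)

/-- Symmetry of the second derivative; this is what makes the differential of `G` closed. -/
theorem dir_dir_comm (hf : IsSmoothLocal f) (j v w : Jet n) :
    HydroPoisson.dir (fun j => HydroPoisson.dir f j w) j v
      = HydroPoisson.dir (fun j => HydroPoisson.dir f j v) j w := by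
  obtain ⟨N, F, hF, h⟩ := hf
  have hF' : ContDiff ℝ ∞ (fderiv ℝ F) := hF.fderiv_right (m := ∞) (by simp)
  have key : ∀ v w : Jet n, HydroPoisson.dir (fun j => HydroPoisson.dir f j w) j v
      = fderiv ℝ (fderiv ℝ F) (j.trunc N) (v.trunc N) (w.trunc N) := by
    intro v w
    rw [dir_aux (N := N) (F := fun y => fderiv ℝ F y (w.trunc N))
      (hF'.clm_apply contDiff_const) (fun j => dir_aux hF h j w),
      fderiv_clm_apply (hF'.differentiable (by simp) _) (differentiableAt_const _)]
    simp
  rw [key, key]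
  exact (hF.contDiffAt.isSymmSndFDerivAt
    (by simpa using WithTop.coe_le_coe.2 (le_top : (2 : ℕ∞) ≤ ⊤))) _ _

theorem totalDeriv (hf : IsSmoothLocal f) : IsSmoothLocal (totalDeriv f) :=
  hf.dir fun i a => coord (i + 1) a

theorem hasDerivAt_curve (hf : IsSmoothLocal f) {γ : ℝ → Jet n} {v : Jet n} {x : ℝ}
    (hγ : ∀ i, HasDerivAt (fun x => γ x i) (v i) x) :
    HasDerivAt (fun x => f (γ x)) (HydroPoisson.dir f (γ x) v) x := by
  obtain ⟨N, F, hF, h⟩ := hf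
  rw [dir_aux hF h]
  simp only [h]
  refine ((hF.differentiable (by simp)) _).hasFDerivAt.comp_hasDerivAt x ?_
  exact hasDerivAt_pi.2 fun i => hγ i

theorem hasDerivAt_jet (hf : IsSmoothLocal f) {u : ℝ → Fin n → ℝ} (hu : ContDiff ℝ ∞ u) (x : ℝ) :
    HasDerivAt (fun x => f (jet u x)) (HydroPoisson.totalDeriv f (jet u x)) x := by
  refine hf.hasDerivAt_curve fun i => ?_
  simp only [shift, jet, iteratedDeriv_succ]
  exact ((hu.differentiable_iteratedDeriv i (by exact_mod_cast WithTop.coe_lt_top _)) x).hasDerivAt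

theorem isScalarLoop (hf : IsSmoothLocal f) {u : ℝ → Fin n → ℝ} (hu : IsLoop u) :
    IsScalarLoop fun x => f (jet u x) := by
  refine ⟨hf.contDiff_comp fun i a => (hu.jet_scalar i a).1, fun x => ?_⟩
  have : jet u (x + 1) = jet u x := by
    funext i a
    exact (hu.jet_scalar i a).2 x
  simp only [this]

theorem iterate_totalDeriv (hf : IsSmoothLocal f) (i : ℕ) :
    IsSmoothLocal (HydroPoisson.totalDeriv^[i] f) := by
  induction i with
  | zero => exact hf
  | succ i ih => rw [Function.iterate_succ_apply']; exact ih.totalDeriv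

theorem iteratedDeriv_jet (hf : IsSmoothLocal f) {u : ℝ → Fin n → ℝ} (hu : ContDiff ℝ ∞ u) (i : ℕ) :
    iteratedDeriv i (fun x => f (jet u x))
      = fun x => (HydroPoisson.totalDeriv^[i] f) (jet u x) := by
  induction i with
  | zero => simp
  | succ i ih =>
    rw [iteratedDeriv_succ, ih, Function.iterate_succ_apply']
    exact funext fun x => ((hf.iterate_totalDeriv i).hasDerivAt_jet hu x).deriv

theorem contDiff_jet_line (hf : IsSmoothLocal f) {u v : ℝ → Fin n → ℝ} (hu : IsLoop u)
    (hv : IsLoop v) :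
    ContDiff ℝ ∞ fun p : ℝ × ℝ => f (jet u p.2 + p.1 • jet v p.2) :=
  hf.contDiff_comp fun i a => ((hu.jet_scalar i a).1.comp contDiff_snd).add
    (contDiff_fst.mul ((hv.jet_scalar i a).1.comp contDiff_snd))

theorem contDiff_dir_jet_line (hf : IsSmoothLocal f) {u v w : ℝ → Fin n → ℝ} (hu : IsLoop u)
    (hv : IsLoop v) (hw : IsLoop w) :
    ContDiff ℝ ∞ fun p : ℝ × ℝ =>
      HydroPoisson.dir f (jet u p.2 + p.1 • jet v p.2) (jet w p.2) := by
  obtain ⟨N, h⟩ := hf.exists_dir_eq_sum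
  simp only [h]
  exact ContDiff.sum fun i _ => ContDiff.sum fun c _ => ((hf.part i c).contDiff_jet_line hu hv).mul
    ((hw.jet_scalar i c).1.comp contDiff_snd)

end IsSmoothLocal

section rules

variable {f h : Jet n → ℝ}

theorem dir_eq_of_hasDerivAt {j v : Jet n} {d : ℝ}
    (h : HasDerivAt (fun s : ℝ => f (j + s • v)) d 0) : dir f j v = d := h.deriv

theorem dir_sub (hf : IsSmoothLocal f) (hh : IsSmoothLocal h) (j v : Jet n) :
    dir (fun j => f j - h j) j v = dir f j v - dir h j v :=
  dir_eq_of_hasDerivAt ((hf.hasDerivAt_zero j v).sub (hh.hasDerivAt_zero j v))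

theorem dir_mul (hf : IsSmoothLocal f) (hh : IsSmoothLocal h) (j v : Jet n) :
    dir (fun j => f j * h j) j v = dir f j v * h j + f j * dir h j v := by
  have := (hf.hasDerivAt_zero j v).mul (hh.hasDerivAt_zero j v)
  simp only [zero_smul, add_zero] at this
  exact dir_eq_of_hasDerivAt this

theorem dir_const (c : ℝ) (j v : Jet n) : dir (fun _ => c) j v = 0 :=
  dir_eq_of_hasDerivAt (hasDerivAt_const _ _)

theorem dir_sum {ι : Type*} {s : Finset ι} {f : ι → Jet n → ℝ}
    (h : ∀ i ∈ s, IsSmoothLocal (f i)) (j v : Jet n) :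
    dir (fun j => ∑ i ∈ s, f i j) j v = ∑ i ∈ s, dir (f i) j v :=
  dir_eq_of_hasDerivAt (HasDerivAt.fun_sum fun i hi => (h i hi).hasDerivAt_zero j v)

theorem dir_coord (i : ℕ) (a : Fin n) (j v : Jet n) : dir (fun j => j i a) j v = v i a := by
  refine dir_eq_of_hasDerivAt ?_
  have := ((hasDerivAt_id (0 : ℝ)).mul_const (v i a)).const_add (j i a)
  simpa using this

theorem dir_comp_smul (hf : IsSmoothLocal f) (t : ℝ) (j v : Jet n) :
    dir (fun j => f (t • j)) j v = t * dir f (t • j) v := by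
  rw [← hf.dir_smul]
  refine dir_eq_of_hasDerivAt ?_
  have := hf.hasDerivAt_zero (t • j) (t • v)
  have e : ∀ s : ℝ, t • j + s • t • v = t • (j + s • v) := fun s => by
    rw [smul_add, smul_comm s t v]
  simpa only [e] using this

end rules

/-! ### Averages along rays -/

/-- `∫ φ(t) f(t j) dt` over the unit interval. -/
def rayInt (φ : ℝ → ℝ) (f : Jet n → ℝ) (j : Jet n) : ℝ := ∫ t in (0 : ℝ)..1, φ t * f (t • j)

theorem IsSmoothLocal.rayInt {f : Jet n → ℝ} (hf : IsSmoothLocal f) {φ : ℝ → ℝ}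
    (hφ : ContDiff ℝ ∞ φ) : IsSmoothLocal (rayInt φ f) := by
  obtain ⟨N, F, hF, h⟩ := hf
  refine ⟨N, fun y => ∫ t in (0 : ℝ)..1, φ t * F (t • y), ?_, fun j => ?_⟩
  · refine contDiff_integral_param (F := fun p : (Fin N → Fin n → ℝ) × ℝ => φ p.2 * F (p.2 • p.1)) ?_
    exact (hφ.comp contDiff_snd).mul (hF.comp (contDiff_snd.smul contDiff_fst))
  · simp only [HydroPoisson.rayInt, h]
    rfl

theorem dir_rayInt {f : Jet n → ℝ} (hf : IsSmoothLocal f) {φ : ℝ → ℝ} (hφ : ContDiff ℝ ∞ φ)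
    (j v : Jet n) : dir (rayInt φ f) j v = ∫ t in (0 : ℝ)..1, φ t * (t * dir f (t • j) v) := by
  refine dir_eq_of_hasDerivAt ?_
  refine hasDerivAt_integral_param (Φ := fun s t => φ t * f (t • (j + s • v)))
    (Φ' := fun s t => φ t * (t * dir f (t • (j + s • v)) v)) ?_ 0 ?_ |>.congr_deriv ?_
  · refine (hφ.comp contDiff_snd).mul (hf.contDiff_comp fun i a => ?_)
    simp only [Pi.smul_apply, Pi.add_apply, smul_eq_mul]
    fun_prop
  · intro t
    have := (hf.comp_smul t).hasDerivAt j v 0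
    rw [dir_comp_smul hf] at this
    exact this.const_mul (φ t)
  · simp

/-- Scaling of jets commutes with the shift, and the factor `t` from the chain rule is absorbed by
linearity in the direction. -/
theorem totalDeriv_rayInt {f : Jet n → ℝ} (hf : IsSmoothLocal f) {φ : ℝ → ℝ}
    (hφ : ContDiff ℝ ∞ φ) (j : Jet n) :
    totalDeriv (rayInt φ f) j = rayInt φ (totalDeriv f) j := by
  rw [totalDeriv, dir_rayInt hf hφ, rayInt]
  refine integral_congr fun t _ => ?_
  simp only [totalDeriv]
  rw [← hf.dir_smul]
  rfl

theorem sub_eq_integral_dir {f : Jet n → ℝ} (hf : IsSmoothLocal f) (j : Jet n) :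
    f j - f 0 = ∫ t in (0 : ℝ)..1, dir f (t • j) j := by
  have hd : ∀ t : ℝ, HasDerivAt (fun t : ℝ => f (t • j)) (dir f (t • j) j) t := fun t => by
    simpa using hf.hasDerivAt 0 j t
  have hc : ContDiff ℝ ∞ fun t : ℝ => f (t • j) :=
    hf.contDiff_comp fun i a => contDiff_id.mul contDiff_const
  rw [integral_eq_sub_of_hasDerivAt (fun t _ => hd t)]
  · simp
  · have : (fun t : ℝ => dir f (t • j) j) = deriv fun t : ℝ => f (t • j) :=
      funext fun t => (hd t).deriv.symm
    rw [this]
    exact ((contDiff_infty_iff_deriv.1 hc).2.continuous).intervalIntegrable _ _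

/-! ### Homogeneous functions of jets -/

/-- The weighted dilation `u_i ↦ c ^ i u_i` of jets. -/
def dilate {n : ℕ} (c : ℝ) (j : Jet n) : Jet n := fun i => c ^ i • j i

/-- A smooth function of finitely many jet coordinates, homogeneous of degree `d` under the
weighted dilations. -/
structure HomLocal {n : ℕ} (d : ℤ) (f : Jet n → ℝ) : Prop where
  smooth : IsSmoothLocal f
  hom : ∀ c : ℝ, 0 < c → ∀ j, f (dilate c j) = c ^ d * f j

theorem dilate_add_smul (c s : ℝ) (j v : Jet n) :
    dilate c (j + s • v) = dilate c j + s • dilate c v := by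
  funext i a
  simp only [dilate, Pi.add_apply, Pi.smul_apply, smul_eq_mul]
  ring

theorem dilate_smul (c s : ℝ) (v : Jet n) : dilate c (s • v) = s • dilate c v := by
  funext i a
  simp only [dilate, Pi.smul_apply, smul_eq_mul]
  ring

theorem dilate_unitJet (c : ℝ) (i : ℕ) (a : Fin n) :
    dilate c (unitJet i a) = c ^ i • unitJet i a := by
  funext k b
  simp only [dilate, unitJet, Pi.smul_apply, smul_eq_mul]
  by_cases h : k = i
  · subst h; rfl
  · simp [Pi.single_eq_of_ne h]

theorem shift_dilate (c : ℝ) (j : Jet n) : shift (dilate c j) = c • dilate c (shift j) := by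
  funext i a
  simp only [dilate, shift, Pi.smul_apply, smul_eq_mul, pow_succ]
  ring

namespace HomLocal

variable {d e : ℤ} {f h : Jet n → ℝ}

theorem congr_degree (hf : HomLocal d f) (h : d = e) : HomLocal e f := h ▸ hf

theorem zero (d : ℤ) : HomLocal d fun _ : Jet n => 0 :=
  ⟨IsSmoothLocal.const 0, fun _ _ _ => by simp⟩

theorem const (c : ℝ) : HomLocal 0 fun _ : Jet n => c :=
  ⟨IsSmoothLocal.const c, fun _ _ _ => by simp⟩

theorem add (hf : HomLocal d f) (hh : HomLocal d h) : HomLocal d fun j => f j + h j :=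
  ⟨hf.smooth.add hh.smooth, fun c hc j => by rw [hf.hom c hc, hh.hom c hc, mul_add]⟩

theorem mul (hf : HomLocal d f) (hh : HomLocal e h) : HomLocal (d + e) fun j => f j * h j :=
  ⟨hf.smooth.mul hh.smooth, fun c hc j => by
    rw [hf.hom c hc, hh.hom c hc, zpow_add₀ hc.ne']; ring⟩

theorem const_mul (c : ℝ) (hf : HomLocal d f) : HomLocal d fun j => c * f j :=
  ((const c).mul hf).congr_degree (zero_add d)

theorem neg (hf : HomLocal d f) : HomLocal d fun j => -f j := by
  simpa using hf.const_mul (-1)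

theorem sub (hf : HomLocal d f) (hh : HomLocal d h) : HomLocal d fun j => f j - h j := by
  simpa [sub_eq_add_neg] using hf.add hh.neg

theorem sum {ι : Type*} {s : Finset ι} {f : ι → Jet n → ℝ} (h : ∀ i ∈ s, HomLocal d (f i)) :
    HomLocal d fun j => ∑ i ∈ s, f i j :=
  ⟨IsSmoothLocal.sum fun i hi => (h i hi).smooth, fun c hc j => by
    rw [Finset.mul_sum]; exact Finset.sum_congr rfl fun i hi => (h i hi).hom c hc j⟩

theorem prod {ι : Type*} {s : Finset ι} {d : ι → ℤ} {f : ι → Jet n → ℝ}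
    (h : ∀ i ∈ s, HomLocal (d i) (f i)) :
    HomLocal (∑ i ∈ s, d i) fun j => ∏ i ∈ s, f i j := by
  classical
  induction s using Finset.induction_on with
  | empty => simpa using const 1
  | insert a s ha ih =>
    simp only [Finset.sum_insert ha, Finset.prod_insert ha]
    exact (h a (by simp)).mul (ih fun i hi => h i (by simp [hi]))

theorem pow (hf : HomLocal d f) (m : ℕ) : HomLocal (m * d) fun j => f j ^ m := by
  have := prod (s := Finset.range m) (d := fun _ => d) (f := fun _ => f) fun _ _ => hf
  simpa using this

theorem coord (i : ℕ) (a : Fin n) : HomLocal i fun j : Jet n => j i a :=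
  ⟨IsSmoothLocal.coord i a, fun _ _ _ => by simp [dilate]⟩

theorem dir_dilate (hf : HomLocal d f) {c : ℝ} (hc : 0 < c) (j v : Jet n) :
    dir f (dilate c j) (dilate c v) = c ^ d * dir f j v := by
  refine dir_eq_of_hasDerivAt ?_
  have := (hf.smooth.hasDerivAt_zero j v).const_mul (c ^ d)
  simpa only [← hf.hom c hc, dilate_add_smul] using this

theorem part (hf : HomLocal d f) (i : ℕ) (a : Fin n) : HomLocal (d - i) (part f i a) := by
  refine ⟨hf.smooth.part i a, fun c hc j => ?_⟩
  have h := hf.dir_dilate hc j (unitJet i a)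
  rw [dilate_unitJet, hf.smooth.dir_smul] at h
  have hci : c ^ i ≠ 0 := (pow_pos hc i).ne'
  refine mul_left_cancel₀ hci (h.trans ?_)
  rw [← mul_assoc, ← zpow_natCast, ← zpow_add₀ hc.ne']
  simp [HydroPoisson.part]

theorem totalDeriv (hf : HomLocal d f) : HomLocal (d + 1) (totalDeriv f) := by
  refine ⟨hf.smooth.totalDeriv, fun c hc j => ?_⟩
  rw [HydroPoisson.totalDeriv, shift_dilate, hf.smooth.dir_smul, hf.dir_dilate hc,
    zpow_add_one₀ hc.ne', HydroPoisson.totalDeriv]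
  ring

theorem iterate_totalDeriv (hf : HomLocal d f) (i : ℕ) :
    HomLocal (d + i) (HydroPoisson.totalDeriv^[i] f) := by
  induction i with
  | zero => simpa using hf
  | succ i ih =>
    rw [Function.iterate_succ_apply']
    exact ih.totalDeriv.congr_degree (by push_cast; ring)

theorem rayInt (hf : HomLocal d f) {φ : ℝ → ℝ} (hφ : ContDiff ℝ ∞ φ) : HomLocal d (rayInt φ f) := by
  refine ⟨hf.smooth.rayInt hφ, fun c hc j => ?_⟩
  rw [HydroPoisson.rayInt, HydroPoisson.rayInt, ← intervalIntegral.integral_const_mul]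
  refine integral_congr fun t _ => ?_
  simp only [← dilate_smul, hf.hom c hc]
  ring

theorem tendsto_dilate (hf : HomLocal d f) (j : Jet n) :
    Tendsto (fun c => f (dilate c j)) (𝓝[>] 0) (𝓝 (f (dilate 0 j))) := by
  have : ContDiff ℝ ∞ fun c => f (dilate c j) := hf.smooth.contDiff_comp fun i a => by
    simp only [dilate, Pi.smul_apply, smul_eq_mul]
    fun_prop
  exact (this.continuous.tendsto 0).mono_left nhdsWithin_le_nhds

/-- A positive power of `c` times `f (dilate c j)` equals `f j` for all `c > 0`, and tends to `0`
with `c` because `f` is continuous at the jet `dilate 0 j`. -/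
theorem eq_zero_of_neg (hf : HomLocal d f) (hd : d < 0) : f = fun _ => 0 := by
  funext j
  obtain ⟨m, rfl⟩ : ∃ m : ℕ, d = -(m + 1 : ℕ) := ⟨(-d - 1).toNat, by omega⟩
  have h1 : Tendsto (fun c : ℝ => c ^ (m + 1) * f (dilate c j)) (𝓝[>] 0)
      (𝓝 (0 ^ (m + 1) * f (dilate 0 j))) :=
    (((continuous_pow (m + 1)).tendsto 0).mono_left nhdsWithin_le_nhds).mul (hf.tendsto_dilate j)
  have h2 : Tendsto (fun _ : ℝ => f j) (𝓝[>] (0 : ℝ)) (𝓝 (0 ^ (m + 1) * f (dilate 0 j))) := by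
    refine h1.congr' ?_
    filter_upwards [self_mem_nhdsWithin] with c hc
    have hc' : (0 : ℝ) < c := hc
    rw [hf.hom c hc', zpow_neg, zpow_natCast, ← mul_assoc, mul_inv_cancel₀ (by positivity), one_mul]
  simpa using tendsto_nhds_unique tendsto_const_nhds h2

theorem eq_dilate_zero (hf : HomLocal 0 f) (j : Jet n) : f j = f (dilate 0 j) := by
  refine tendsto_nhds_unique ?_ (hf.tendsto_dilate j)
  refine tendsto_const_nhds.congr' ?_
  filter_upwards [self_mem_nhdsWithin] with c hc
  simp [hf.hom c hc]

/-- Jets of constant loops are fixed by dilations, so `f j = 2 ^ d * f j`. -/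
theorem eq_zero_of_const (hf : HomLocal d f) (hd : 0 < d) {j : Jet n} (hj : ∀ i, j (i + 1) = 0) :
    f j = 0 := by
  have h := hf.hom 2 two_pos j
  have e : dilate 2 j = j := by
    funext i
    cases i with
    | zero => simp [dilate]
    | succ i => simp [dilate, hj]
  rw [e] at h
  have h2 : (1 : ℝ) < 2 ^ d := one_lt_zpow₀ one_lt_two hd
  by_contra hne
  exact h2.ne (mul_right_cancel₀ hne (by rw [one_mul]; exact h))

theorem part_eq_zero (hf : HomLocal d f) {i : ℕ} (hi : d < i) (c : Fin n) :
    HydroPoisson.part f i c = fun _ => 0 :=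
  (hf.part i c).eq_zero_of_neg (by omega)

/-- The partial derivative in `u_i` has degree `d - i`, so it vanishes for `i > d`. The range of
summation is thus bounded by the degree alone. -/
theorem dir_eq_sum (hf : HomLocal d f) {N : ℕ} (hN : d < N) (j v : Jet n) :
    dir f j v = ∑ i ∈ Finset.range N, ∑ c, HydroPoisson.part f i c j * v i c := by
  obtain ⟨M, hM⟩ := hf.smooth.exists_dir_eq_sum
  have key : ∀ K L : ℕ, K ≤ L → (∀ i, K ≤ i → i < L → ∀ c, HydroPoisson.part f i c j * v i c = 0) →
      ∑ i ∈ Finset.range K, ∑ c, HydroPoisson.part f i c j * v i c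
        = ∑ i ∈ Finset.range L, ∑ c, HydroPoisson.part f i c j * v i c := by
    intro K L hKL h0
    refine Finset.sum_subset (Finset.range_mono hKL) fun i hi hi' => ?_
    simp only [Finset.mem_range, not_lt] at hi hi'
    exact Finset.sum_eq_zero fun c _ => h0 i hi' hi c
  have hz : ∀ i, N ≤ i → ∀ c, HydroPoisson.part f i c j * v i c = 0 := by
    intro i hi c
    rw [hf.part_eq_zero (by omega) c, zero_mul]
  rw [hM]
  rcases le_total M N with h | h
  · refine key M N h fun i hi _ c => ?_
    -- The expansion up to `M`, taken in the direction of a coordinate of order `i ≥ M`, shows that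
    -- this partial derivative vanishes.
    have h1 := hM j (unitJet i c)
    rw [Finset.sum_eq_zero fun k hk => Finset.sum_eq_zero fun b _ => ?_] at h1
    · rw [HydroPoisson.part, h1, zero_mul]
    · have : k ≠ i := by have := Finset.mem_range.1 hk; omega
      simp [unitJet, Pi.single_eq_of_ne this]
  · exact (key N M h fun i hi _ c => hz i hi c).symm

theorem euler (hf : HomLocal d f) (j : Jet n) : d * f j = dir f j fun i => (i : ℝ) • j i := by
  have h1 : HasDerivAt (fun c : ℝ => f (dilate c j)) (dir f (dilate 1 j) fun i => (i : ℝ) • j i) 1 := by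
    refine hf.smooth.hasDerivAt_curve fun i => ?_
    have := (hasDerivAt_pow i (1 : ℝ)).smul_const (j i)
    rw [one_pow, mul_one] at this
    exact this
  have h2 : HasDerivAt (fun c : ℝ => c ^ d * f j) (d * f j) 1 := by
    have := (hasDerivAt_zpow d (1 : ℝ) (Or.inl one_ne_zero)).mul_const (f j)
    simpa using this
  have e : dilate 1 j = j := by funext i; simp [dilate]
  rw [e] at h1
  refine h2.unique (h1.congr_of_eventuallyEq ?_)
  filter_upwards [lt_mem_nhds (zero_lt_one' ℝ)] with c hc
  exact (hf.hom c hc j).symm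

end HomLocal

/-! ### Comparison with homogeneous differential polynomials -/

theorem IsHomDiffPoly.homLocal {d : ℕ} {f : Jet n → ℝ} (hf : IsHomDiffPoly d f) :
    HomLocal d f := by
  obtain ⟨S, c, hd, hc, hf⟩ := hf
  have e : f = fun j => ∑ m ∈ S, c m (j 0) * m.prod (fun q e => j (q.1 + 1) q.2 ^ e) := funext hf
  rw [e]
  refine HomLocal.sum fun m hm => ?_
  have h1 : HomLocal 0 fun j : Jet n => c m (j 0) :=
    ⟨⟨1, fun y => c m (y 0), (hc m hm).comp (by fun_prop), fun j => rfl⟩, fun _ _ _ => by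
      simp [dilate]⟩
  have h2 : HomLocal d fun j : Jet n => m.prod (fun q e => j (q.1 + 1) q.2 ^ e) := by
    refine (HomLocal.prod (s := m.support) fun q _ =>
      (HomLocal.coord (q.1 + 1) q.2).pow (m q)).congr_degree ?_
    rw [← hd m hm]
    simp [Finsupp.sum]
  exact (h1.mul h2).congr_degree (zero_add _)

namespace IsHomDiffPoly

variable {d : ℕ} {f h : Jet n → ℝ}

theorem zero (d : ℕ) : IsHomDiffPoly d fun _ : Jet n => 0 :=
  ⟨∅, 0, by simp, by simp, by simp⟩

theorem const_mul (r : ℝ) (hf : IsHomDiffPoly d f) : IsHomDiffPoly d fun j => r * f j := by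
  obtain ⟨S, c, hd, hc, hf⟩ := hf
  exact ⟨S, fun m y => r * c m y, hd, fun m hm => contDiff_const.mul (hc m hm), fun j => by
    simp only [hf, Finset.mul_sum, mul_assoc]⟩

theorem add (hf : IsHomDiffPoly d f) (hh : IsHomDiffPoly d h) :
    IsHomDiffPoly d fun j => f j + h j := by
  classical
  obtain ⟨S, c, hd, hc, hf⟩ := hf
  obtain ⟨S', c', hd', hc', hh⟩ := hh
  refine ⟨S ∪ S', fun m y => (if m ∈ S then c m y else 0) + if m ∈ S' then c' m y else 0,
    fun m hm => ?_, fun m _ => ?_, fun j => ?_⟩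
  · exact (Finset.mem_union.1 hm).elim (hd m) (hd' m)
  · refine ContDiff.add ?_ ?_
    · split_ifs with h
      exacts [hc m h, contDiff_const]
    · split_ifs with h
      exacts [hc' m h, contDiff_const]
  · simp only [hf, hh, add_mul, Finset.sum_add_distrib, ite_mul, zero_mul, Finset.sum_ite_mem]
    rw [Finset.union_inter_cancel_left, Finset.union_inter_cancel_right]

theorem sum {ι : Type*} {s : Finset ι} {f : ι → Jet n → ℝ}
    (h : ∀ i ∈ s, IsHomDiffPoly d (f i)) : IsHomDiffPoly d fun j => ∑ i ∈ s, f i j := by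
  classical
  induction s using Finset.induction_on with
  | empty => simpa using zero d
  | insert a s ha ih =>
    simp only [Finset.sum_insert ha]
    exact (h a (by simp)).add (ih fun i hi => h i (by simp [hi]))

theorem mul_coord (hf : IsHomDiffPoly d f) (i : ℕ) (a : Fin n) :
    IsHomDiffPoly (d + (i + 1)) fun j => f j * j (i + 1) a := by
  classical
  obtain ⟨S, c, hd, hc, hf⟩ := hf
  refine ⟨S.image fun m => m + Finsupp.single (i, a) 1, fun m => c (m - Finsupp.single (i, a) 1),
    ?_, ?_, fun j => ?_⟩
  · simp only [Finset.forall_mem_image]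
    intro m hm
    rw [Finsupp.sum_add_index' (by simp) (by intros; ring), hd m hm,
      Finsupp.sum_single_index (by simp)]
    simp
  · simp only [Finset.forall_mem_image, add_tsub_cancel_right]
    exact hc
  · rw [Finset.sum_image fun m _ m' _ h => add_right_cancel h]
    simp only [hf, Finset.sum_mul]
    refine Finset.sum_congr rfl fun m _ => ?_
    rw [add_tsub_cancel_right, Finsupp.prod_add_index' (by simp) (by intros; rw [pow_add]),
      Finsupp.prod_single_index (by simp)]
    simp only [pow_one]
    ring

end IsHomDiffPoly

/-- By Euler's identity, `f` is the sum of `(i / d) u_i ∂f/∂u_i`, whose partial derivatives with `i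
≥ 1` have lower degree, so induction applies. In degree `0`, letting the dilation tend to `0` shows
that `f` depends on `u` only. -/
theorem HomLocal.isHomDiffPoly {d : ℕ} {f : Jet n → ℝ} (hf : HomLocal d f) :
    IsHomDiffPoly d f := by
  induction d using Nat.strong_induction_on generalizing f with
  | _ d ih =>
    rcases Nat.eq_zero_or_pos d with rfl | hd
    · refine ⟨{0}, fun _ y => f (Pi.single 0 y), by simp, ?_, fun j => ?_⟩
      · intro _ _
        refine hf.smooth.contDiff_comp fun i a => ?_
        cases i with
        | zero => simpa using contDiff_apply ℝ ℝ a
        | succ i => simpa using contDiff_const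
      · have e : dilate 0 j = Pi.single 0 (j 0) := by
          funext i
          cases i with
          | zero => simp [dilate]
          | succ i => simp [dilate]
        simp [hf.eq_dilate_zero j, e]
    · have e : f = fun j => ∑ i ∈ Finset.range (d + 1), ∑ c,
          ((i : ℝ) / d) * (HydroPoisson.part f i c j * j i c) := by
        funext j
        have hd' : (d : ℝ) ≠ 0 := by positivity
        have h := hf.euler j
        rw [hf.dir_eq_sum (N := d + 1) (by push_cast; omega)] at h
        refine mul_left_cancel₀ hd' ?_
        rw [show (d : ℝ) * f j = ((d : ℤ) : ℝ) * f j by simp, h]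
        simp only [Finset.mul_sum, Pi.smul_apply, smul_eq_mul]
        refine Finset.sum_congr rfl fun i _ => Finset.sum_congr rfl fun c _ => ?_
        field_simp
      rw [e]
      refine IsHomDiffPoly.sum fun i hi => IsHomDiffPoly.sum fun c _ => ?_
      rcases i with _ | i
      -- The term `i = 0`, whose partial derivative would not have lower degree, carries the factor
      -- `0 / d`.
      · simpa using IsHomDiffPoly.zero d
      · have hi' : i + 1 ≤ d := by have := Finset.mem_range.1 hi; omega
        refine IsHomDiffPoly.const_mul _ ?_
        have := (ih (d - (i + 1)) (by omega)
          ((hf.part (i + 1) c).congr_degree (by omega))).mul_coord i c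
        rwa [Nat.sub_add_cancel hi'] at this

/-! ### The constant operator `g d/dx` -/

/-- The value of `g d/dx` at `α`. -/
def hydroOp (g : Matrix (Fin n) (Fin n) ℝ) (α : ℝ → Fin n → ℝ) : ℝ → Fin n → ℝ :=
  fun x a => ∑ b, g a b * jet α x 1 b

section hydro

variable (g : Matrix (Fin n) (Fin n) ℝ) {α β : ℝ → Fin n → ℝ}

theorem hydro_act (u α : ℝ → Fin n → ℝ) : (hydro g).act u α = hydroOp g α := by
  funext x a
  simp [DiffOp.act, hydro, hydroOp, jet]

theorem hydro_frechet (u α v : ℝ → Fin n → ℝ) : (hydro g).frechet u α v = 0 := by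
  funext x
  simp [DiffOp.frechet, hydro_act]

theorem jet_one_eq_deriv (hα : ContDiff ℝ ∞ α) (x : ℝ) (b : Fin n) :
    jet α x 1 b = deriv (fun x => α x b) x := by
  rw [jet, iteratedDeriv_apply_pi hα, iteratedDeriv_one]

theorem isLoop_hydroOp (hα : IsLoop α) : IsLoop (hydroOp g α) :=
  isLoop_iff.2 fun _ => IsScalarLoop.sum fun b _ => (IsScalarLoop.const _).mul (hα.jet_scalar 1 b)

theorem hydroOp_add_smul (hα : IsLoop α) (hβ : IsLoop β) (s : ℝ) :
    hydroOp g (α + s • β) = hydroOp g α + s • hydroOp g β := by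
  funext x a
  simp only [hydroOp, jet_add_smul hα.1 hβ.1, Pi.add_apply, Pi.smul_apply, smul_eq_mul, mul_add,
    Finset.sum_add_distrib, Finset.mul_sum]
  congr 1
  exact Finset.sum_congr rfl fun b _ => by ring

theorem hydroOp_const (c : Fin n → ℝ) : hydroOp g (fun _ => c) = 0 := by
  funext x a
  simp [hydroOp, jet_const_succ c x 0]

variable {g}

theorem pairing_hydroOp (hg : g.IsSymm) (hα : IsLoop α) (hβ : IsLoop β) :
    pairing (hydroOp g α) β = -pairing α (hydroOp g β) := by
  have key : ∀ a b, ∫ x in (0 : ℝ)..1, g a b * (jet α x 1 b * β x a)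
      = -∫ x in (0 : ℝ)..1, g a b * (α x b * jet β x 1 a) := by
    intro a b
    rw [intervalIntegral.integral_const_mul, intervalIntegral.integral_const_mul]
    simp only [jet_one_eq_deriv hα.1, jet_one_eq_deriv hβ.1]
    rw [(hα.scalar b).integral_deriv_mul (hβ.scalar a), mul_neg]
  have e1 : ∀ x, ∑ a, hydroOp g α x a * β x a = ∑ a, ∑ b, g a b * (jet α x 1 b * β x a) := by
    intro x
    simp only [hydroOp, Finset.sum_mul, mul_assoc]
  have e2 : ∀ x, ∑ a, α x a * hydroOp g β x a = ∑ a, ∑ b, g a b * (α x b * jet β x 1 a) := by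
    intro x
    simp only [hydroOp, Finset.mul_sum]
    rw [Finset.sum_comm]
    refine Finset.sum_congr rfl fun a _ => Finset.sum_congr rfl fun b _ => ?_
    rw [hg.apply]
    ring
  have i1 : ∀ a b, IsScalarLoop fun x => g a b * (jet α x 1 b * β x a) := fun a b =>
    (IsScalarLoop.const _).mul ((hα.jet_scalar 1 b).mul (hβ.scalar a))
  have i2 : ∀ a b, IsScalarLoop fun x => g a b * (α x b * jet β x 1 a) := fun a b =>
    (IsScalarLoop.const _).mul ((hα.scalar b).mul (hβ.jet_scalar 1 a))
  unfold pairing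
  simp only [e1, e2]
  rw [intervalIntegral.integral_finsetSum fun a _ =>
      (IsScalarLoop.sum fun b _ => i1 a b).continuous.intervalIntegrable _ _,
    intervalIntegral.integral_finsetSum fun a _ =>
      (IsScalarLoop.sum fun b _ => i2 a b).continuous.intervalIntegrable _ _,
    ← Finset.sum_neg_distrib]
  refine Finset.sum_congr rfl fun a _ => ?_
  rw [intervalIntegral.integral_finsetSum fun b _ => (i1 a b).continuous.intervalIntegrable _ _,
    intervalIntegral.integral_finsetSum fun b _ => (i2 a b).continuous.intervalIntegrable _ _,
    ← Finset.sum_neg_distrib]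
  exact Finset.sum_congr rfl fun b _ => key a b

/-- Every loop of mean zero is in the image of `g d/dx`. -/
theorem exists_hydroOp_eq (hreg : IsUnit g.det) {v : ℝ → Fin n → ℝ} (hv : IsLoop v)
    (h0 : ∀ a, ∫ x in (0 : ℝ)..1, v x a = 0) : ∃ w, IsLoop w ∧ hydroOp g w = v := by
  have hl : ∀ b, IsScalarLoop fun x => ∑ a, g⁻¹ b a * v x a := fun b =>
    IsScalarLoop.sum fun a _ => (IsScalarLoop.const _).mul (hv.scalar a)
  have hz : ∀ b, ∫ x in (0 : ℝ)..1, ∑ a, g⁻¹ b a * v x a = 0 := by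
    intro b
    rw [intervalIntegral.integral_finsetSum fun a _ =>
      ((IsScalarLoop.const _).mul (hv.scalar a)).continuous.intervalIntegrable _ _]
    simp [h0]
  choose w hw hd using fun b => exists_scalarLoop_deriv_eq (hl b) (hz b)
  have hwl : IsLoop fun x b => w b x := isLoop_iff.2 hw
  refine ⟨fun x b => w b x, hwl, ?_⟩
  funext x a
  simp only [hydroOp, jet_one_eq_deriv hwl.1]
  have : ∀ b, deriv (fun x => w b x) x = (g⁻¹.mulVec (v x)) b := fun b => by
    rw [hd b]; rfl
  simp only [this]
  change g.mulVec (g⁻¹.mulVec (v x)) a = v x a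
  rw [Matrix.mulVec_mulVec, Matrix.mul_nonsing_inv _ hreg, Matrix.one_mulVec]

/-- Every loop agrees near a given point with a loop in the image of `g d/dx`. -/
theorem exists_hydroOp_eventuallyEq (hreg : IsUnit g.det) {v : ℝ → Fin n → ℝ} (hv : IsLoop v)
    (x₀ : ℝ) : ∃ w, IsLoop w ∧ hydroOp g w =ᶠ[𝓝 x₀] v := by
  have hl : ∀ b, ContDiff ℝ ∞ fun x => ∑ a, g⁻¹ b a * v x a := fun b =>
    (IsScalarLoop.sum fun a _ => (IsScalarLoop.const _).mul (hv.scalar a)).1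
  -- The primitive need not be periodic when `v` has nonzero mean; only its germ is kept.
  obtain ⟨w, hw, he⟩ := exists_isLoop_eventuallyEq (contDiff_pi.2 fun b =>
    (exists_contDiff_primitive (hl b)).1) x₀
  refine ⟨w, hw, ?_⟩
  filter_upwards [he.eventuallyEq_nhds] with x hx
  funext a
  have : ∀ b, jet w x 1 b = (g⁻¹.mulVec (v x)) b := fun b => by
    have hxb : (fun x => w x b) =ᶠ[𝓝 x] fun x => ∫ t in (0 : ℝ)..x, ∑ a, g⁻¹ b a * v t a :=
      hx.mono fun y hy => congrFun hy b
    rw [jet_one_eq_deriv hw.1, hxb.deriv_eq,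
      ((exists_contDiff_primitive (hl b)).2 x).deriv]
    rfl
  simp only [hydroOp, this]
  change g.mulVec (g⁻¹.mulVec (v x)) a = v x a
  rw [Matrix.mulVec_mulVec, Matrix.mul_nonsing_inv _ hreg, Matrix.one_mulVec]

end hydro

/-! ### Operators with homogeneous coefficients -/

/-- The coefficient of `dᵐ/dxᵐ` is homogeneous of degree `D - m` under weighted dilations. -/
def DiffOp.HomCoeff (Q : DiffOp n) (D : ℤ) : Prop :=
  ∀ m ∈ Finset.range (Q.order + 1), ∀ a b, HomLocal (D - m) (Q.coeff m a b)

theorem DiffOp.IsHomogeneous.homCoeff {Q : DiffOp n} {d : ℕ} (h : Q.IsHomogeneous d) :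
    Q.HomCoeff d := by
  intro m hm a b
  have hm' : m ≤ d := by have := Finset.mem_range.1 hm; have := h.1; omega
  exact (h.2 m (d - m) (by omega) a b).homLocal.congr_degree (by omega)

theorem sum_sum_sum_sum_comm {ι₁ ι₂ ι₃ ι₄ : Type*} (s₁ : Finset ι₁) (s₂ : Finset ι₂)
    (s₃ : Finset ι₃) (s₄ : Finset ι₄) (f : ι₁ → ι₂ → ι₃ → ι₄ → ℝ) :
    ∑ i ∈ s₁, ∑ c ∈ s₂, ∑ m ∈ s₃, ∑ b ∈ s₄, f i c m b
      = ∑ m ∈ s₃, ∑ b ∈ s₄, ∑ i ∈ s₁, ∑ c ∈ s₂, f i c m b := by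
  have h := Finset.sum_comm (s := s₁ ×ˢ s₂) (t := s₃ ×ˢ s₄) (f := fun p q => f p.1 p.2 q.1 q.2)
  simpa only [Finset.sum_product] using h

namespace DiffOp.HomCoeff

variable {Q : DiffOp n} {D : ℤ} {u v α β γ : ℝ → Fin n → ℝ}

/-- The point and the argument vary together because the potential contains `Q_u w` with `u = g
w_x`, where both depend on `w`. -/
theorem hasDerivAt_act (hQ : Q.HomCoeff D) (hu : IsLoop u) (hv : IsLoop v) (hα : IsLoop α)
    (hγ : IsLoop γ) (s x : ℝ) (a : Fin n) :
    HasDerivAt (fun s : ℝ => Q.act (u + s • v) (α + s • γ) x a)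
      (∑ m ∈ Finset.range (Q.order + 1), ∑ b,
        (dir (Q.coeff m a b) (jet (u + s • v) x) (jet v x) * jet (α + s • γ) x m b
          + Q.coeff m a b (jet (u + s • v) x) * jet γ x m b)) s := by
  have e : (fun s : ℝ => Q.act (u + s • v) (α + s • γ) x a) = fun s : ℝ =>
      ∑ m ∈ Finset.range (Q.order + 1), ∑ b,
        Q.coeff m a b (jet u x + s • jet v x) * (jet α x m b + s * jet γ x m b) := by
    funext s
    simp only [DiffOp.act, jet_add_smul hu.1 hv.1]
    refine Finset.sum_congr rfl fun m _ => Finset.sum_congr rfl fun b _ => ?_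
    rw [show iteratedDeriv m (α + s • γ) x b = jet (α + s • γ) x m b from rfl,
      jet_add_smul hα.1 hγ.1]
    rfl
  rw [e]
  refine HasDerivAt.fun_sum fun m hm => HasDerivAt.fun_sum fun b _ => ?_
  have h1 := (hQ m hm a b).smooth.hasDerivAt (jet u x) (jet v x) s
  have h2 : HasDerivAt (fun s : ℝ => jet α x m b + s * jet γ x m b) (jet γ x m b) s := by
    simpa using ((hasDerivAt_id s).mul_const (jet γ x m b)).const_add (jet α x m b)
  rw [jet_add_smul hu.1 hv.1, jet_add_smul hα.1 hγ.1]
  exact h1.mul h2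

theorem frechet_apply (hQ : Q.HomCoeff D) (hu : IsLoop u) (hα : IsLoop α) (hv : IsLoop v)
    (x : ℝ) (a : Fin n) :
    Q.frechet u α v x a = ∑ m ∈ Finset.range (Q.order + 1), ∑ b,
      dir (Q.coeff m a b) (jet u x) (jet v x) * jet α x m b := by
  have hd : ∀ a, HasDerivAt (fun s : ℝ => Q.act (u + s • v) α x a)
      (∑ m ∈ Finset.range (Q.order + 1), ∑ b,
      dir (Q.coeff m a b) (jet u x) (jet v x) * jet α x m b) 0 := by
    intro a
    have h := hQ.hasDerivAt_act hu hv hα (IsLoop.const 0) 0 x a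
    have hz : ∀ m, jet (fun _ : ℝ => (0 : Fin n → ℝ)) x m = 0 := fun m => by
      simp [jet]
    have e : (fun _ : ℝ => (0 : Fin n → ℝ)) = 0 := rfl
    rw [e] at hz
    simpa [e, hz] using h
  rw [DiffOp.frechet, deriv_pi fun a => (hd a).differentiableAt]
  exact (hd a).deriv

theorem isLoop_act (hQ : Q.HomCoeff D) (hu : IsLoop u) (hα : IsLoop α) : IsLoop (Q.act u α) :=
  isLoop_iff.2 fun a => IsScalarLoop.sum fun m hm => IsScalarLoop.sum fun b _ =>
    ((hQ m hm a b).smooth.isScalarLoop hu).mul (hα.jet_scalar m b)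

theorem isScalarLoop_dir {d : ℤ} {f : Jet n → ℝ} (hf : HomLocal d f) (hu : IsLoop u)
    (hv : IsLoop v) : IsScalarLoop fun x => dir f (jet u x) (jet v x) := by
  obtain ⟨N, h⟩ := hf.smooth.exists_dir_eq_sum
  simp only [h]
  exact IsScalarLoop.sum fun i _ => IsScalarLoop.sum fun c _ =>
    ((hf.smooth.part i c).isScalarLoop hu).mul (hv.jet_scalar i c)

theorem isLoop_frechet (hQ : Q.HomCoeff D) (hu : IsLoop u) (hα : IsLoop α) (hv : IsLoop v) :
    IsLoop (Q.frechet u α v) := by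
  refine isLoop_iff.2 fun a => ?_
  simp only [hQ.frechet_apply hu hα hv]
  exact IsScalarLoop.sum fun m hm => IsScalarLoop.sum fun b _ =>
    (isScalarLoop_dir (hQ m hm a b) hu hv).mul (hα.jet_scalar m b)

theorem exists_isAdjointValue_frechet (hQ : Q.HomCoeff D) (hu : IsLoop u) (hα : IsLoop α)
    (hβ : IsLoop β) : ∃ w, IsAdjointValue (Q.frechet u α) β w := by
  refine ⟨_, isAdjointValue_green (N := D.toNat + 1)
    (p := fun a i c x => ∑ m ∈ Finset.range (Q.order + 1), ∑ b,
      part (Q.coeff m a b) i c (jet u x) * jet α x m b) (fun a i c => ?_) (fun v hv x a => ?_) hβ⟩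
  · exact IsScalarLoop.sum fun m hm => IsScalarLoop.sum fun b _ =>
      (((hQ m hm a b).smooth.part i c).isScalarLoop hu).mul (hα.jet_scalar m b)
  · rw [hQ.frechet_apply hu hα hv]
    simp only [Finset.sum_mul]
    rw [sum_sum_sum_sum_comm]
    refine Finset.sum_congr rfl fun m hm => Finset.sum_congr rfl fun b _ => ?_
    rw [(hQ m hm a b).dir_eq_sum (N := D.toNat + 1) (by omega)]
    simp only [Finset.sum_mul]
    refine Finset.sum_congr rfl fun i _ => Finset.sum_congr rfl fun c _ => ?_
    ring

theorem hasDerivAt_pairing_act (hQ : Q.HomCoeff D) (hu : IsLoop u) (hv : IsLoop v)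
    (hα : IsLoop α) (hγ : IsLoop γ) (hβ : IsLoop β) (s : ℝ) :
    HasDerivAt (fun s : ℝ => pairing (Q.act (u + s • v) (α + s • γ)) β)
      (pairing (Q.frechet (u + s • v) (α + s • γ) v) β + pairing (Q.act (u + s • v) γ) β) s := by
  have hus := hu.add (hv.smul s)
  have hαs := hα.add (hγ.smul s)
  rw [← pairing_add_left (hQ.isLoop_frechet hus hαs hv) (hQ.isLoop_act hus hγ) hβ]
  refine hasDerivAt_integral_param (Φ := fun s x => ∑ a, Q.act (u + s • v) (α + s • γ) x a * β x a)
    (Φ' := fun s x => ∑ a, (Q.frechet (u + s • v) (α + s • γ) v + Q.act (u + s • v) γ) x a * β x a)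
    ?_ s fun x => ?_
  · refine ContDiff.sum fun a _ => ContDiff.mul ?_ ((hβ.scalar a).1.comp contDiff_snd)
    refine ContDiff.sum fun m hm => ContDiff.sum fun b _ => ContDiff.mul ?_ ?_
    · simp only [jet_add_smul hu.1 hv.1]
      exact (hQ m hm a b).smooth.contDiff_jet_line hu hv
    · have e : ∀ p : ℝ × ℝ, iteratedDeriv m (α + p.1 • γ) p.2 b
          = jet α p.2 m b + p.1 * jet γ p.2 m b := fun p => by
        rw [show iteratedDeriv m (α + p.1 • γ) p.2 b = jet (α + p.1 • γ) p.2 m b from rfl,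
          jet_add_smul hα.1 hγ.1]
        rfl
      simp only [e]
      exact ((hα.jet_scalar m b).1.comp contDiff_snd).add
        (contDiff_fst.mul ((hγ.jet_scalar m b).1.comp contDiff_snd))
  · refine HasDerivAt.fun_sum fun a _ => HasDerivAt.mul_const ?_ _
    refine (hQ.hasDerivAt_act hu hv hα hγ s x a).congr_deriv ?_
    simp only [Pi.add_apply, hQ.frechet_apply hus hαs hv, DiffOp.act, Finset.sum_add_distrib]
    rfl

end DiffOp.HomCoeff

theorem adj_zero (β : ℝ → Fin n → ℝ) : adj (fun _ => 0) β = 0 :=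
  IsAdjointValue.adj_eq ⟨IsLoop.const 0, fun v _ => by rw [pairing_zero_left, pairing_comm, pairing_zero_left]⟩

theorem DiffOp.act_zero (Q : DiffOp n) (u : ℝ → Fin n → ℝ) : Q.act u 0 = 0 := by
  funext x a
  have : ∀ k, iteratedDeriv k (0 : ℝ → Fin n → ℝ) x = 0 := fun k => by
    rw [show (0 : ℝ → Fin n → ℝ) = fun _ => 0 from rfl, iteratedDeriv_const]
    simp
  simp [DiffOp.act, this]

/-- The cocycle condition, paired with a third one-form. -/
theorem IsCocycle.pairing_eq {g : Matrix (Fin n) (Fin n) ℝ} (hg : g.IsSymm) {Q : DiffOp n} {D : ℤ}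
    (hQ : Q.HomCoeff D) (hc : IsCocycle (hydro g) Q) {u α β γ : ℝ → Fin n → ℝ} (hu : IsLoop u)
    (hα : IsLoop α) (hβ : IsLoop β) (hγ : IsLoop γ) :
    pairing (Q.frechet u α (hydroOp g β)) γ - pairing (Q.frechet u β (hydroOp g α)) γ
      - pairing (Q.frechet u α (hydroOp g γ)) β = 0 := by
  obtain ⟨w, hw⟩ := hQ.exists_isAdjointValue_frechet hu hα hβ
  have h := hc u α β hu hα hβ
  -- The operator `g d/dx` does not depend on `u`, so the three terms with its derivative drop out
  -- of the bracket.
  have hz : (hydro g).frechet u α = fun _ => 0 := funext fun v => hydro_frechet g u α v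
  rw [schouten, hydro_frechet, hydro_frechet, hz, adj_zero, DiffOp.act_zero, hw.adj_eq] at h
  simp only [hydro_act, sub_self, add_zero, zero_add] at h
  have h' := (smul_eq_zero.1 h).resolve_left (by norm_num)
  have l1 := hQ.isLoop_frechet hu hα (isLoop_hydroOp g hβ)
  have l2 := hQ.isLoop_frechet hu hβ (isLoop_hydroOp g hα)
  have h2 : pairing (Q.frechet u α (hydroOp g β) - Q.frechet u β (hydroOp g α) + hydroOp g w) γ
      = 0 := by rw [h', pairing_zero_left]
  -- Skewness of `P = g d/dx` and the definition of the adjoint turn `⟨P w, γ⟩` into `-⟨Q'(α; Pγ),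
  -- β⟩`.
  rw [pairing_add_left (l1.sub l2) (isLoop_hydroOp g hw.1) hγ, pairing_sub_left l1 l2 hγ,
    pairing_hydroOp hg hw.1 hγ, pairing_comm w, ← hw.2 _ (isLoop_hydroOp g hγ)] at h2
  linarith

/-! ### Homogeneous vector fields -/

namespace VField

variable {X : VField n} {d : ℤ} {u v w β : ℝ → Fin n → ℝ}

theorem frechet_apply (hX : ∀ a, HomLocal d (X a)) (hu : IsLoop u) (hv : IsLoop v) (x : ℝ)
    (a : Fin n) : VField.frechet X u v x a = dir (X a) (jet u x) (jet v x) := by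
  have hd : ∀ a, HasDerivAt (fun s : ℝ => VField.val X (u + s • v) x a)
      (dir (X a) (jet u x) (jet v x)) 0 := by
    intro a
    simp only [VField.val, jet_add_smul hu.1 hv.1]
    exact (hX a).smooth.hasDerivAt_zero _ _
  rw [VField.frechet, deriv_pi fun a => (hd a).differentiableAt]
  exact (hd a).deriv

theorem isLoop_val (hX : ∀ a, HomLocal d (X a)) (hu : IsLoop u) : IsLoop (VField.val X u) :=
  isLoop_iff.2 fun a => (hX a).smooth.isScalarLoop hu

theorem isLoop_frechet (hX : ∀ a, HomLocal d (X a)) (hu : IsLoop u) (hv : IsLoop v) :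
    IsLoop (VField.frechet X u v) := by
  refine isLoop_iff.2 fun a => ?_
  simp only [frechet_apply hX hu hv]
  exact DiffOp.HomCoeff.isScalarLoop_dir (hX a) hu hv

theorem isAdjointValue_frechet (hX : ∀ a, HomLocal d (X a)) (hu : IsLoop u) (hβ : IsLoop β)
    {N : ℕ} (hN : d < N) : IsAdjointValue (VField.frechet X u) β
      (greenAdj N fun i c x => ∑ a, part (X a) i c (jet u x) * β x a) := by
  refine isAdjointValue_green (p := fun a i c x => part (X a) i c (jet u x))
    (fun a i c => ((hX a).smooth.part i c).isScalarLoop hu) (fun v hv x a => ?_) hβ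
  rw [frechet_apply hX hu hv, (hX a).dir_eq_sum hN]

theorem hasDerivAt_pairing_val (hX : ∀ a, HomLocal d (X a)) (hu : IsLoop u) (hv : IsLoop v)
    (hβ : IsLoop β) :
    HasDerivAt (fun s : ℝ => pairing (VField.val X (u + s • v)) β)
      (pairing (VField.frechet X u v) β) 0 := by
  refine hasDerivAt_integral_param (Φ := fun s x => ∑ a, VField.val X (u + s • v) x a * β x a)
    (Φ' := fun s x => ∑ a, dir (X a) (jet u x + s • jet v x) (jet v x) * β x a)
    ?_ 0 (fun x => ?_) |>.congr_deriv ?_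
  · refine ContDiff.sum fun a _ => ContDiff.mul ?_ ((hβ.scalar a).1.comp contDiff_snd)
    simp only [VField.val, jet_add_smul hu.1 hv.1]
    exact (hX a).smooth.contDiff_jet_line hu hv
  · refine HasDerivAt.fun_sum fun a _ => HasDerivAt.mul_const ?_ _
    simp only [VField.val, jet_add_smul hu.1 hv.1]
    exact (hX a).smooth.hasDerivAt _ _ _
  · simp only [pairing, frechet_apply hX hu hv, zero_smul, add_zero]

/-- The pairing with `β` of the second derivative of `X`. -/
theorem hasDerivAt_pairing_frechet (hX : ∀ a, HomLocal d (X a)) (hu : IsLoop u) (hv : IsLoop v)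
    (hw : IsLoop w) {γ : ℝ → Fin n → ℝ} (hβ : IsLoop β) (hγ : IsLoop γ) :
    HasDerivAt (fun s : ℝ => pairing (VField.frechet X (u + s • v) w) (β + s • γ))
      ((∫ x in (0 : ℝ)..1, ∑ a, dir (fun j => dir (X a) j (jet w x)) (jet u x) (jet v x) * β x a)
        + pairing (VField.frechet X u w) γ) 0 := by
  have hd : ∀ x a, IsSmoothLocal fun j => dir (X a) j (jet w x) := fun x a =>
    (hX a).smooth.dir fun i b => IsSmoothLocal.const _
  have e : (fun s : ℝ => pairing (VField.frechet X (u + s • v) w) (β + s • γ)) = fun s : ℝ =>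
      ∫ x in (0 : ℝ)..1, ∑ a, dir (X a) (jet u x + s • jet v x) (jet w x) * (β x a + s * γ x a) := by
    funext s
    simp only [pairing, frechet_apply hX (hu.add (hv.smul s)) hw, jet_add_smul hu.1 hv.1]
    rfl
  rw [e]
  refine hasDerivAt_integral_param
    (Φ := fun s x => ∑ a, dir (X a) (jet u x + s • jet v x) (jet w x) * (β x a + s * γ x a))
    (Φ' := fun s x => ∑ a, (dir (fun j => dir (X a) j (jet w x)) (jet u x + s • jet v x) (jet v x)
      * (β x a + s * γ x a) + dir (X a) (jet u x + s • jet v x) (jet w x) * γ x a))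
    ?_ 0 (fun x => ?_) |>.congr_deriv ?_
  · refine ContDiff.sum fun a _ => ContDiff.mul ((hX a).smooth.contDiff_dir_jet_line hu hv hw) ?_
    exact ((hβ.scalar a).1.comp contDiff_snd).add (contDiff_fst.mul ((hγ.scalar a).1.comp contDiff_snd))
  · refine HasDerivAt.fun_sum fun a _ => HasDerivAt.mul ((hd x a).hasDerivAt _ _ _) ?_
    simpa using ((hasDerivAt_id (0 : ℝ)).mul_const (γ x a)).const_add (β x a)
  · simp only [zero_smul, add_zero, zero_mul, pairing, frechet_apply hX hu hw,
      Finset.sum_add_distrib]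
    refine intervalIntegral.integral_add ?_ ?_
    · refine Continuous.intervalIntegrable ?_ _ _
      refine continuous_finsetSum _ fun a _ => Continuous.mul ?_ (hβ.scalar a).continuous
      have e2 : ∀ x, dir (fun j => dir (X a) j (jet w x)) (jet u x) (jet v x)
          = ∑ i ∈ Finset.range (d.toNat + 1), ∑ c, dir (part (X a) i c) (jet u x) (jet v x)
            * jet w x i c := by
        intro x
        have e3 : (fun j => dir (X a) j (jet w x)) = fun j =>
            ∑ i ∈ Finset.range (d.toNat + 1), ∑ c, part (X a) i c j * jet w x i c :=
          funext fun j => (hX a).dir_eq_sum (by omega) _ _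
        have hs : ∀ i c, IsSmoothLocal fun j => part (X a) i c j * jet w x i c := fun i c =>
          ((hX a).smooth.part i c).mul (IsSmoothLocal.const _)
        rw [e3, dir_sum fun i _ => IsSmoothLocal.sum fun c _ => hs i c]
        refine Finset.sum_congr rfl fun i _ => ?_
        rw [dir_sum fun c _ => hs i c]
        refine Finset.sum_congr rfl fun c _ => ?_
        rw [dir_mul ((hX a).smooth.part i c) (IsSmoothLocal.const _), dir_const, mul_zero, add_zero]
      simp only [e2]
      exact (IsScalarLoop.sum fun i _ => IsScalarLoop.sum fun c _ =>
        (DiffOp.HomCoeff.isScalarLoop_dir ((hX a).part i c) hu hv).mul (hw.jet_scalar i c)).continuous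
    · exact (IsScalarLoop.sum fun a _ => (DiffOp.HomCoeff.isScalarLoop_dir (hX a) hu hw).mul
        (hγ.scalar a)).continuous.intervalIntegrable _ _

end VField

/-! ### The brackets of the Casimirs -/

/-- On a constant one-form only the coefficient of order zero survives. -/
theorem DiffOp.act_dCasimir (Q : DiffOp n) (u : ℝ → Fin n → ℝ) (b : Fin n) (x : ℝ) (a : Fin n) :
    Q.act u (dCasimir b) x a = Q.coeff 0 a b (jet u x) := by
  rw [DiffOp.act, Finset.sum_range_succ', Finset.sum_eq_zero fun m _ => ?_]
  · simp [dCasimir, Pi.single_apply]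
  · refine Finset.sum_eq_zero fun c _ => ?_
    have h : iteratedDeriv (m + 1) (dCasimir b) x = 0 := jet_const_succ (Pi.single b 1) x m
    simp [h]

theorem DiffOp.frechet_zero (Q : DiffOp n) (u α : ℝ → Fin n → ℝ) : Q.frechet u α 0 = 0 := by
  funext x
  simp [DiffOp.frechet]

/-- The cocycle identity with first argument `e_b`, where `g d/dx` kills `e_b`: the 1-form `β ↦ ⟨Q
e_b, β⟩` is closed in the coordinate `w`. -/
theorem pairing_frechet_dCasimir {g : Matrix (Fin n) (Fin n) ℝ} (hg : g.IsSymm) {Q : DiffOp n}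
    {D : ℤ} (hQ : Q.HomCoeff D) (hc : IsCocycle (hydro g) Q) {u β γ : ℝ → Fin n → ℝ}
    (hu : IsLoop u) (hβ : IsLoop β) (hγ : IsLoop γ) (b : Fin n) :
    pairing (Q.frechet u (dCasimir b) (hydroOp g β)) γ
      = pairing (Q.frechet u (dCasimir b) (hydroOp g γ)) β := by
  have h := hc.pairing_eq hg hQ hu (isLoop_dCasimir b) hβ hγ
  have e : hydroOp g (dCasimir b) = 0 := hydroOp_const g _
  rw [e, DiffOp.frechet_zero, pairing_zero_left] at h
  linarith

/-- The bracket is constant on the segment from the mean of `u` to `u`, and vanishes at the constant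
loop. -/
theorem casimirBracket_eq_zero {g : Matrix (Fin n) (Fin n) ℝ} (hg : g.IsSymm)
    (hreg : IsUnit g.det) {Q : DiffOp n} {D : ℤ} (hD : 0 < D) (hQ : Q.HomCoeff D)
    (hc : IsCocycle (hydro g) Q) (a b : Fin n) {u : ℝ → Fin n → ℝ} (hu : IsLoop u) :
    casimirBracket Q a b u = 0 := by
  -- The loop `u - c` has mean zero, so it is `P w` for some loop `w`.
  let c : ℝ → Fin n → ℝ := fun _ a => ∫ x in (0 : ℝ)..1, u x a
  have hcl : IsLoop c := IsLoop.const _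
  have hvl : IsLoop (u - c) := hu.sub hcl
  obtain ⟨w, hw, hwe⟩ := exists_hydroOp_eq hreg hvl fun a => by
    simp only [Pi.sub_apply, c]
    rw [intervalIntegral.integral_sub ((hu.scalar a).continuous.intervalIntegrable _ _)
      (by simp)]
    simp
  have hd : ∀ s, HasDerivAt (fun s : ℝ => pairing (Q.act (c + s • (u - c)) (dCasimir a))
      (dCasimir b)) 0 s := by
    intro s
    have h := hQ.hasDerivAt_pairing_act hcl hvl (isLoop_dCasimir a) (IsLoop.const 0)
      (isLoop_dCasimir b) s
    have e : (fun _ : ℝ => (0 : Fin n → ℝ)) = 0 := rfl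
    have e2 : hydroOp g (dCasimir b) = 0 := hydroOp_const g _
    have hus : IsLoop (c + s • (u - c)) := hcl.add (hvl.smul s)
    simp only [e, smul_zero, add_zero, DiffOp.act_zero, pairing_zero_left] at h
    -- Closedness exchanges `w` and `e_b`, and the direction of differentiation becomes `P e_b = 0`.
    rwa [← hwe, pairing_frechet_dCasimir hg hQ hc (by rwa [hwe]) hw (isLoop_dCasimir b), e2,
      DiffOp.frechet_zero, pairing_zero_left, hwe] at h
  have h01 := is_const_of_deriv_eq_zero (fun s => (hd s).differentiableAt) (fun s => (hd s).deriv) 1 0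
  have e1 : c + (1 : ℝ) • (u - c) = u := by simp
  have e0 : c + (0 : ℝ) • (u - c) = c := by simp
  simp only [e1, e0] at h01
  rw [casimirBracket, h01]
  -- The coefficient of order zero has degree `D > 0`, so it vanishes at constant loops.
  have h0 : Q.act c (dCasimir a) = 0 := by
    funext x d
    rw [DiffOp.act_dCasimir]
    exact (hQ 0 (by simp) d a).eq_zero_of_const (by simpa using hD) fun i => jet_const_succ _ x i
  rw [h0, pairing_zero_left]

theorem casimirBracket_eq_integral (Q : DiffOp n) (a b : Fin n) (u : ℝ → Fin n → ℝ) :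
    casimirBracket Q a b u = ∫ x in (0 : ℝ)..1, Q.coeff 0 b a (jet u x) := by
  simp only [casimirBracket, pairing, DiffOp.act_dCasimir]
  simp [dCasimir, Pi.single_apply]

/-! ### Densities with vanishing integral are total derivatives -/

theorem IsSmoothLocal.continuous_ray {f : Jet n → ℝ} (hf : IsSmoothLocal f) (j : Jet n) :
    Continuous fun t : ℝ => f (t • j) :=
  (hf.contDiff_comp (γ := fun t : ℝ => t • j)
    fun _ _ => contDiff_id.mul contDiff_const).continuous

theorem rayInt_sum {ι : Type*} {s : Finset ι} {f : ι → Jet n → ℝ}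
    (h : ∀ i ∈ s, IsSmoothLocal (f i)) {φ : ℝ → ℝ} (hφ : Continuous φ) (j : Jet n) :
    rayInt φ (fun j => ∑ i ∈ s, f i j) j = ∑ i ∈ s, rayInt φ (f i) j := by
  simp only [rayInt, Finset.mul_sum]
  exact intervalIntegral.integral_finsetSum fun i hi =>
    (hφ.mul ((h i hi).continuous_ray j)).intervalIntegrable _ _

theorem rayInt_const_mul (φ : ℝ → ℝ) (c : ℝ) (f : Jet n → ℝ) (j : Jet n) :
    rayInt φ (fun j => c * f j) j = c * rayInt φ f j := by
  simp only [rayInt, ← intervalIntegral.integral_const_mul]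
  refine integral_congr fun t _ => ?_
  ring

/-- The variational derivative of a density whose integral vanishes on all loops is zero. -/
theorem greenAdj_part_eq_zero {d : ℤ} {f : Jet n → ℝ} (hf : HomLocal d f) {N : ℕ} (hN : d < N)
    (h0 : ∀ u, IsLoop u → ∫ x in (0 : ℝ)..1, f (jet u x) = 0) {u : ℝ → Fin n → ℝ}
    (hu : IsLoop u) : greenAdj N (fun i c x => part f i c (jet u x)) = 0 := by
  have hp : ∀ i c, IsScalarLoop fun x => part f i c (jet u x) := fun i c =>
    (hf.smooth.part i c).isScalarLoop hu
  refine eq_of_pairing_eq (isLoop_greenAdj hp) (IsLoop.const 0) fun v hv => ?_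
  rw [pairing_comm, ← integral_green hp hv]
  rw [pairing_zero_left]
  have hd := hasDerivAt_integral_param (Φ := fun s x => f (jet u x + s • jet v x))
    (Φ' := fun s x => dir f (jet u x + s • jet v x) (jet v x))
    (hf.smooth.contDiff_jet_line hu hv) 0 fun x => hf.smooth.hasDerivAt _ _ _
  have e : (fun s : ℝ => ∫ x in (0 : ℝ)..1, f (jet u x + s • jet v x)) = fun _ => 0 := by
    funext s
    refine Eq.trans ?_ (h0 _ (hu.add (hv.smul s)))
    simp only [jet_add_smul hu.1 hv.1]
  rw [e] at hd
  have h := hd.unique (hasDerivAt_const _ _)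
  simp only [zero_smul, add_zero] at h
  refine Eq.trans (integral_congr fun x _ => ?_) h
  exact (hf.dir_eq_sum hN _ _).symm

/-- The density `B` in the integration by parts
`f u_i = (-1)^i f^{(i)} u + B_x`, averaged along rays. -/
def partsTerm (c : Fin n) : ℕ → (Jet n → ℝ) → Jet n → ℝ
  | 0, _ => fun _ => 0
  | i + 1, f => fun j => rayInt (fun _ => 1) f j * j i c - partsTerm c i (totalDeriv f) j

theorem HomLocal.partsTerm {d : ℤ} {f : Jet n → ℝ} (hf : HomLocal d f) (c : Fin n) (i : ℕ) :
    HomLocal (d + i - 1) (partsTerm c i f) := by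
  induction i generalizing d f with
  | zero => exact HomLocal.zero _
  | succ i ih =>
    refine HomLocal.sub ?_ ?_
    · exact ((hf.rayInt contDiff_const).mul (HomLocal.coord i c)).congr_degree (by push_cast; ring)
    · exact (ih hf.totalDeriv).congr_degree (by push_cast; ring)

/-- Differentiating `f u_i` gives `f u_{i+1}` and `f_x u_i`; the recursion treats the second term in
the same way, with one derivative of `u` less. -/
theorem totalDeriv_partsTerm {d : ℤ} {f : Jet n → ℝ} (hf : HomLocal d f) (c : Fin n) (i : ℕ)
    (j : Jet n) : totalDeriv (partsTerm c i f) j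
      = rayInt (fun _ => 1) f j * j i c
        - (-1) ^ i * rayInt (fun _ => 1) (totalDeriv^[i] f) j * j 0 c := by
  induction i generalizing d f with
  | zero => simp [totalDeriv, partsTerm, dir_const]
  | succ i ih =>
    have h1 := hf.smooth.rayInt (contDiff_const (c := (1 : ℝ)))
    have e : totalDeriv (partsTerm c (i + 1) f) j = totalDeriv (rayInt (fun _ => 1) f) j * j i c
        + rayInt (fun _ => 1) f j * j (i + 1) c - totalDeriv (partsTerm c i (totalDeriv f)) j := by
      simp only [totalDeriv, partsTerm]
      rw [dir_sub (h1.mul (IsSmoothLocal.coord i c)) (hf.totalDeriv.partsTerm c i).smooth,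
        dir_mul h1 (IsSmoothLocal.coord i c), dir_coord]
      rfl
    rw [e, ih hf.totalDeriv, totalDeriv_rayInt hf.smooth contDiff_const, Function.iterate_succ_apply]
    ring

/-- A density whose total derivative is `f`, if the integral of `f` vanishes on all loops. -/
def primitive (N : ℕ) (f : Jet n → ℝ) (j : Jet n) : ℝ :=
  ∑ i ∈ Finset.range N, ∑ c, partsTerm c i (part f i c) j

theorem HomLocal.primitive {d : ℤ} {f : Jet n → ℝ} (hf : HomLocal d f) (N : ℕ) :
    HomLocal (d - 1) (primitive N f) :=
  HomLocal.sum fun i _ => HomLocal.sum fun c _ =>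
    ((hf.part i c).partsTerm c i).congr_degree (by ring)

/-- Integrating the derivative of `f` along the ray through the jet writes `f` as a sum of averaged
`∂f/∂u_i` times `u_i`. Moving all derivatives off `u` costs the total derivative of `primitive N f`
and leaves `u` times the averaged variational derivative, which vanishes. -/
theorem totalDeriv_primitive {d : ℤ} (hd : 0 < d) {f : Jet n → ℝ} (hf : HomLocal d f) {N : ℕ}
    (hN : d < N) (h0 : ∀ u, IsLoop u → ∫ x in (0 : ℝ)..1, f (jet u x) = 0) {u : ℝ → Fin n → ℝ}
    (hu : IsLoop u) (x : ℝ) : totalDeriv (primitive N f) (jet u x) = f (jet u x) := by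
  have hs : ∀ i c, IsSmoothLocal (partsTerm c i (part f i c)) := fun i c =>
    ((hf.part i c).partsTerm c i).smooth
  have e : totalDeriv (primitive N f) (jet u x) = ∑ i ∈ Finset.range N, ∑ c,
      totalDeriv (partsTerm c i (part f i c)) (jet u x) := by
    unfold totalDeriv primitive
    rw [dir_sum fun i _ => IsSmoothLocal.sum fun c _ => hs i c]
    exact Finset.sum_congr rfl fun i _ => dir_sum (fun c _ => hs i c) _ _
  have e1 : ∑ i ∈ Finset.range N, ∑ c, rayInt (fun _ => 1) (part f i c) (jet u x) * jet u x i c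
      = f (jet u x) := by
    have h := sub_eq_integral_dir hf.smooth (jet u x)
    -- The value at the origin of the ray vanishes because `f` has positive degree.
    rw [hf.eq_zero_of_const hd (j := 0) fun _ => rfl, sub_zero] at h
    rw [h]
    simp only [hf.dir_eq_sum hN]
    have hi : ∀ i c, Continuous fun t : ℝ => part f i c (t • jet u x) * jet u x i c := fun i c =>
      ((hf.smooth.part i c).continuous_ray _).mul continuous_const
    rw [intervalIntegral.integral_finsetSum fun i _ =>
      (continuous_finsetSum _ fun c _ => hi i c).intervalIntegrable _ _]
    refine Finset.sum_congr rfl fun i _ => ?_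
    rw [intervalIntegral.integral_finsetSum fun c _ => (hi i c).intervalIntegrable _ _]
    refine Finset.sum_congr rfl fun c _ => ?_
    rw [intervalIntegral.integral_mul_const]
    simp [rayInt]
  have e2 : ∀ c, ∑ i ∈ Finset.range N,
      (-1) ^ i * rayInt (fun _ => 1) (totalDeriv^[i] (part f i c)) (jet u x) = 0 := by
    intro c
    simp only [← rayInt_const_mul]
    rw [← rayInt_sum (fun i _ => (IsSmoothLocal.const _).mul
      ((hf.smooth.part i c).iterate_totalDeriv i)) continuous_const]
    unfold rayInt
    have hz : ∀ t : ℝ, ∑ i ∈ Finset.range N,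
        (-1) ^ i * totalDeriv^[i] (part f i c) (t • jet u x) = 0 := by
      intro t
      -- The scaled loop `t u` is again a loop, so the variational derivative vanishes all along the
      -- ray.
      have h := congrFun (congrFun (greenAdj_part_eq_zero hf hN h0 (hu.smul t)) x) c
      rw [greenAdj, Finset.sum_congr rfl fun i _ => by
        rw [(hf.smooth.part i c).iteratedDeriv_jet (hu.smul t).1 i]] at h
      simpa only [jet_smul, Pi.zero_apply] using h
    simp [hz]
  rw [e]
  simp only [totalDeriv_partsTerm (hf.part _ _), Finset.sum_sub_distrib, e1]
  rw [Finset.sum_comm, Finset.sum_eq_zero fun c _ => ?_, sub_zero]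
  rw [← Finset.sum_mul, e2, zero_mul]

/-! ### Averages of operators along rays -/

/-- The operator with coefficients averaged along rays. -/
def DiffOp.rayInt (φ : ℝ → ℝ) (Q : DiffOp n) : DiffOp n where
  order := Q.order
  coeff m a b := HydroPoisson.rayInt φ (Q.coeff m a b)

theorem integral_integral_swap_of_continuous {K : ℝ → ℝ → ℝ}
    (hK : Continuous fun p : ℝ × ℝ => K p.1 p.2) :
    ∫ x in (0 : ℝ)..1, ∫ t in (0 : ℝ)..1, K t x = ∫ t in (0 : ℝ)..1, ∫ x in (0 : ℝ)..1, K t x := by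
  refine intervalIntegral_intervalIntegral_swap ?_
  have hc : Continuous fun p : ℝ × ℝ => K p.2 p.1 := hK.comp continuous_swap
  refine (hc.continuousOn.integrableOn_compact
    (isCompact_uIcc.prod isCompact_uIcc)).mono_set
    (Set.prod_mono Set.uIoc_subset_uIcc Set.uIoc_subset_uIcc)

theorem pairing_integral {K : ℝ → ℝ → Fin n → ℝ} {φ : ℝ → ℝ} (hφ : Continuous φ)
    (hK : ∀ a, Continuous fun p : ℝ × ℝ => K p.1 p.2 a) {β : ℝ → Fin n → ℝ} (hβ : IsLoop β) :
    pairing (fun x a => ∫ t in (0 : ℝ)..1, φ t * K t x a) β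
      = ∫ t in (0 : ℝ)..1, φ t * pairing (K t) β := by
  have hc : ∀ a, Continuous fun p : ℝ × ℝ => φ p.1 * K p.1 p.2 a * β p.2 a := fun a =>
    ((hφ.comp continuous_fst).mul (hK a)).mul ((hβ.scalar a).continuous.comp continuous_snd)
  have e1 : ∀ x, ∑ a, (∫ t in (0 : ℝ)..1, φ t * K t x a) * β x a
      = ∫ t in (0 : ℝ)..1, ∑ a, φ t * K t x a * β x a := by
    intro x
    have hx : ∀ a, Continuous fun t => φ t * K t x a * β x a := fun a =>
      (hc a).comp (by fun_prop : Continuous fun t : ℝ => (t, x))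
    rw [intervalIntegral.integral_finsetSum fun a _ => (hx a).intervalIntegrable _ _]
    simp only [intervalIntegral.integral_mul_const]
  have e2 : ∀ t, φ t * pairing (K t) β = ∫ x in (0 : ℝ)..1, ∑ a, φ t * K t x a * β x a := by
    intro t
    rw [pairing, ← intervalIntegral.integral_const_mul]
    simp only [Finset.mul_sum, mul_assoc]
  simp only [e2]
  rw [pairing]
  simp only [e1]
  exact integral_integral_swap_of_continuous (continuous_finsetSum _ fun a _ => hc a)

namespace DiffOp.HomCoeff

variable {Q : DiffOp n} {D : ℤ} {u v α β γ : ℝ → Fin n → ℝ} {φ : ℝ → ℝ}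

theorem rayInt (hQ : Q.HomCoeff D) (hφ : ContDiff ℝ ∞ φ) : (Q.rayInt φ).HomCoeff D :=
  fun m hm a b => (hQ m hm a b).rayInt hφ

theorem contDiff_act_ray (hQ : Q.HomCoeff D) (hu : IsLoop u) (hα : IsLoop α) (a : Fin n) :
    ContDiff ℝ ∞ fun p : ℝ × ℝ => Q.act (p.1 • u) α p.2 a := by
  refine ContDiff.sum fun m hm => ContDiff.sum fun b _ => ContDiff.mul ?_
    ((hα.jet_scalar m b).1.comp contDiff_snd)
  simp only [jet_smul]
  exact (hQ m hm a b).smooth.contDiff_comp fun i c =>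
    contDiff_fst.mul ((hu.jet_scalar i c).1.comp contDiff_snd)

theorem contDiff_frechet_ray (hQ : Q.HomCoeff D) (hu : IsLoop u) (hα : IsLoop α) (hv : IsLoop v)
    (a : Fin n) : ContDiff ℝ ∞ fun p : ℝ × ℝ => Q.frechet (p.1 • u) α v p.2 a := by
  simp only [hQ.frechet_apply (hu.smul _) hα hv, jet_smul]
  refine ContDiff.sum fun m hm => ContDiff.sum fun b _ => ContDiff.mul ?_
    ((hα.jet_scalar m b).1.comp contDiff_snd)
  simp only [(hQ m hm a b).dir_eq_sum (N := D.toNat + 1) (by omega)]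
  exact ContDiff.sum fun i _ => ContDiff.sum fun c _ => ContDiff.mul
    (((hQ m hm a b).smooth.part i c).contDiff_comp fun i c =>
      contDiff_fst.mul ((hu.jet_scalar i c).1.comp contDiff_snd))
    ((hv.jet_scalar i c).1.comp contDiff_snd)

theorem pairing_rayInt_act (hQ : Q.HomCoeff D) (hφ : Continuous φ) (hu : IsLoop u)
    (hα : IsLoop α) (hβ : IsLoop β) : pairing ((Q.rayInt φ).act u α) β
      = ∫ t in (0 : ℝ)..1, φ t * pairing (Q.act (t • u) α) β := by
  rw [← pairing_integral hφ (fun a => (hQ.contDiff_act_ray hu hα a).continuous) hβ]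
  congr 1
  funext x a
  have hc : ∀ m ∈ Finset.range (Q.order + 1), ∀ b, Continuous fun t : ℝ =>
      φ t * (Q.coeff m a b (t • jet u x) * jet α x m b) := fun m hm b =>
    hφ.mul (((hQ m hm a b).smooth.continuous_ray _).mul continuous_const)
  simp only [DiffOp.act, Finset.mul_sum, jet_smul]
  change _ = ∫ t in (0 : ℝ)..1, ∑ m ∈ Finset.range (Q.order + 1), ∑ b,
    φ t * (Q.coeff m a b (t • jet u x) * jet α x m b)
  rw [intervalIntegral.integral_finsetSum fun m hm => (continuous_finsetSum _ fun b _ =>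
    hc m hm b).intervalIntegrable _ _]
  refine Finset.sum_congr rfl fun m hm => ?_
  rw [intervalIntegral.integral_finsetSum fun b _ => (hc m hm b).intervalIntegrable _ _]
  refine Finset.sum_congr rfl fun b _ => ?_
  simp only [← mul_assoc, intervalIntegral.integral_mul_const]
  rfl

/-- The weight gains a factor `t` since a variation `v` of `u` moves `t u` by `t v`. -/
theorem pairing_rayInt_frechet (hQ : Q.HomCoeff D) (hφ : ContDiff ℝ ∞ φ) (hu : IsLoop u)
    (hα : IsLoop α) (hv : IsLoop v) (hβ : IsLoop β) : pairing ((Q.rayInt φ).frechet u α v) β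
      = ∫ t in (0 : ℝ)..1, φ t * t * pairing (Q.frechet (t • u) α v) β := by
  have hφ' : Continuous fun t => φ t * t := hφ.continuous.mul continuous_id
  rw [← pairing_integral hφ' (fun a => (hQ.contDiff_frechet_ray hu hα hv a).continuous) hβ]
  congr 1
  funext x a
  rw [(hQ.rayInt hφ).frechet_apply hu hα hv]
  simp only [hQ.frechet_apply (hu.smul _) hα hv]
  have hd : ∀ m ∈ Finset.range (Q.order + 1), ∀ b, Continuous fun t : ℝ =>
      dir (Q.coeff m a b) (t • jet u x) (jet v x) := fun m hm b =>
    IsSmoothLocal.continuous_ray (f := fun j => dir (Q.coeff m a b) j (jet v x))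
      ((hQ m hm a b).smooth.dir fun i c => IsSmoothLocal.const _) _
  have hc : ∀ m ∈ Finset.range (Q.order + 1), ∀ b, Continuous fun t : ℝ =>
      φ t * t * (dir (Q.coeff m a b) (t • jet u x) (jet v x) * jet α x m b) := fun m hm b =>
    hφ'.mul ((hd m hm b).mul continuous_const)
  simp only [Finset.mul_sum, jet_smul]
  rw [intervalIntegral.integral_finsetSum fun m hm => (continuous_finsetSum _ fun b _ =>
    hc m hm b).intervalIntegrable _ _]
  refine Finset.sum_congr rfl fun m hm => ?_
  rw [intervalIntegral.integral_finsetSum fun b _ => (hc m hm b).intervalIntegrable _ _]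
  refine Finset.sum_congr rfl fun b _ => ?_
  simp only [← mul_assoc, intervalIntegral.integral_mul_const]
  congr 1
  refine (dir_rayInt (hQ m hm a b).smooth hφ _ _).trans ?_
  simp only [← mul_assoc]

theorem hasDerivAt_pairing_act_ray (hQ : Q.HomCoeff D) (hu : IsLoop u) (hα : IsLoop α)
    (hβ : IsLoop β) (t : ℝ) :
    HasDerivAt (fun t : ℝ => pairing (Q.act (t • u) α) β) (pairing (Q.frechet (t • u) α u) β) t := by
  have e : (fun _ : ℝ => (0 : Fin n → ℝ)) = 0 := rfl
  have h := hQ.hasDerivAt_pairing_act (IsLoop.const 0) hu hα (IsLoop.const 0) hβ t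
  simpa only [e, zero_add, smul_zero, add_zero, DiffOp.act_zero, pairing_zero_left] using h

theorem contDiff_pairing_act_ray (hQ : Q.HomCoeff D) (hu : IsLoop u) (hα : IsLoop α)
    (hβ : IsLoop β) : ContDiff ℝ ∞ fun t : ℝ => pairing (Q.act (t • u) α) β :=
  contDiff_integral_param (F := fun p : ℝ × ℝ => ∑ a, Q.act (p.1 • u) α p.2 a * β p.2 a)
    (ContDiff.sum fun a _ => (hQ.contDiff_act_ray hu hα a).mul
      ((hβ.scalar a).1.comp contDiff_snd))

/-- The integrand is the derivative of `p(t) ⟨Q_{tu} α, β⟩`. This is the homotopy formula of the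
Poincaré lemma, used with `p = t (1 - t)` for the 1-forms `Q e_b` and with `p = t²` for the 2-form.
-/
theorem integral_deriv_mul_pairing (hQ : Q.HomCoeff D) (hu : IsLoop u) (hα : IsLoop α)
    (hβ : IsLoop β) {p p' : ℝ → ℝ} (hp : ∀ t, HasDerivAt p (p' t) t) (hp' : Continuous p') :
    ∫ t in (0 : ℝ)..1, (p' t * pairing (Q.act (t • u) α) β
        + p t * pairing (Q.frechet (t • u) α u) β)
      = p 1 * pairing (Q.act u α) β - p 0 * pairing (Q.act 0 α) β := by
  have hd := hQ.hasDerivAt_pairing_act_ray hu hα hβ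
  have hc := hQ.contDiff_pairing_act_ray hu hα hβ
  have hdc : Continuous fun t : ℝ => pairing (Q.frechet (t • u) α u) β := by
    rw [← funext fun t => (hd t).deriv]
    exact (contDiff_infty_iff_deriv.1 hc).2.continuous
  have hpc : Continuous p := continuous_iff_continuousAt.2 fun t => (hp t).continuousAt
  rw [integral_eq_sub_of_hasDerivAt (fun t _ => (hp t).mul (hd t))
    (((hp'.mul hc.continuous).add (hpc.mul hdc)).intervalIntegrable _ _)]
  simp

theorem continuous_pairing_frechet_ray (hQ : Q.HomCoeff D) (hu : IsLoop u) (hα : IsLoop α)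
    (hv : IsLoop v) (hβ : IsLoop β) :
    Continuous fun t : ℝ => pairing (Q.frechet (t • u) α v) β :=
  (contDiff_integral_param (F := fun p : ℝ × ℝ => ∑ a, Q.frechet (p.1 • u) α v p.2 a * β p.2 a)
    (ContDiff.sum fun a _ => (hQ.contDiff_frechet_ray hu hα hv a).mul
      ((hβ.scalar a).1.comp contDiff_snd))).continuous

end DiffOp.HomCoeff

/-! ### Jets in the image of `g d/dx` -/

theorem HomLocal.invCoord (g : Matrix (Fin n) (Fin n) ℝ) (i : ℕ) (b : Fin n) :
    HomLocal i fun j : Jet n => g⁻¹.mulVec (j i) b := by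
  simp only [Matrix.mulVec, dotProduct]
  exact HomLocal.sum fun a _ => (HomLocal.coord i a).const_mul _

/-- All derivatives of `w` of positive order are linear functions of the jet of `u = g w_x`; only
`w` itself is not local in `u`. -/
theorem inv_mulVec_jet_hydroOp {g : Matrix (Fin n) (Fin n) ℝ} (hreg : IsUnit g.det)
    {w : ℝ → Fin n → ℝ} (hw : IsLoop w) (i : ℕ) (x : ℝ) :
    g⁻¹.mulVec (jet (hydroOp g w) x i) = jet w x (i + 1) := by
  have h : jet (hydroOp g w) x i = g.mulVec (jet w x (i + 1)) := by
    funext a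
    have e : (fun x => hydroOp g w x a) = fun x => ∑ b, g a b • iteratedDeriv 1 (fun x => w x b) x := by
      funext x
      simp only [hydroOp, jet, iteratedDeriv_apply_pi hw.1, smul_eq_mul]
    have hs : ∀ b, ContDiff ℝ ∞ (iteratedDeriv 1 fun x => w x b) := fun b =>
      ((hw.scalar b).iteratedDeriv 1).1
    have hi : ((i : ℕ∞ω)) ≤ ∞ := by exact_mod_cast le_top
    rw [jet, iteratedDeriv_apply_pi (isLoop_hydroOp g hw).1, e,
      iteratedDeriv_fun_sum fun b _ => show ContDiffAt ℝ i
        (fun x => g a b • iteratedDeriv 1 (fun x => w x b) x) x from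
        (((hs b).of_le hi).const_smul (g a b)).contDiffAt]
    refine Finset.sum_congr rfl fun b _ => ?_
    rw [show (fun x => g a b • iteratedDeriv 1 (fun x => w x b) x)
      = g a b • iteratedDeriv 1 (fun x => w x b) from rfl, iteratedDeriv_const_smul_field]
    rw [jet, iteratedDeriv_apply_pi hw.1, iteratedDeriv_one, iteratedDeriv_succ']
    rfl
  rw [h, Matrix.mulVec_mulVec, Matrix.nonsing_inv_mul _ hreg, Matrix.one_mulVec]

/-! ### The vector field compensating the explicit dependence on the primitive of a loop -/

/-- The densities `f_b` of functionals whose differentials are, in the coordinates `w` with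
`u = g w_x`, the averages of `Q e_b` along rays. -/
def compensator (g : Matrix (Fin n) (Fin n) ℝ) (Q : DiffOp n) (N : ℕ) : VField n := fun b j =>
  -∑ a, g⁻¹.mulVec (j 0) a * rayInt (fun t => 1 - t) (primitive N (Q.coeff 0 a b)) j

section compensator

variable {g : Matrix (Fin n) (Fin n) ℝ} {Q : DiffOp n} {D : ℤ} {N : ℕ} {w β : ℝ → Fin n → ℝ}

theorem contDiff_one_sub : ContDiff ℝ ∞ fun t : ℝ => 1 - t := contDiff_const.sub contDiff_id

theorem DiffOp.HomCoeff.coeff_zero (hQ : Q.HomCoeff D) (a b : Fin n) :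
    HomLocal D (Q.coeff 0 a b) := by
  simpa using hQ 0 (by simp) a b

theorem homLocal_compensator (hQ : Q.HomCoeff D) (b : Fin n) :
    HomLocal (D - 1) (compensator g Q N b) :=
  (HomLocal.sum fun a _ => ((HomLocal.invCoord g 0 a).mul
    (((hQ.coeff_zero a b).primitive N).rayInt contDiff_one_sub)).congr_degree (by simp)).neg

/-- The averaged coefficients of order zero are total derivatives of the functions `h a`, and one
integration by parts replaces `w` by `w_x = g⁻¹ u`. The weight `1 - t` comes from averaging `t
Q_{tu}` once more along the ray. -/
theorem pairing_compensator (hg : g.IsSymm) (hreg : IsUnit g.det) (hD : 0 < D) (hN : D < N)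
    (hQ : Q.HomCoeff D) (hc : IsCocycle (hydro g) Q) (hw : IsLoop w) (b : Fin n) :
    pairing (VField.val (compensator g Q N) (hydroOp g w)) (dCasimir b)
      = pairing ((Q.rayInt fun t => 1 - t).act (hydroOp g w) (dCasimir b)) w := by
  have hu := isLoop_hydroOp g hw
  let h : Fin n → Jet n → ℝ := fun a => rayInt (fun t => 1 - t) (primitive N (Q.coeff 0 a b))
  have hh : ∀ a, HomLocal (D - 1) (h a) := fun a =>
    ((hQ.coeff_zero a b).primitive N).rayInt contDiff_one_sub
  have hl : ∀ a, IsScalarLoop fun x => h a (jet (hydroOp g w) x) := fun a =>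
    (hh a).smooth.isScalarLoop hu
  have hder : ∀ a x, deriv (fun x => h a (jet (hydroOp g w) x)) x
      = rayInt (fun t => 1 - t) (Q.coeff 0 a b) (jet (hydroOp g w) x) := by
    intro a x
    rw [((hh a).smooth.hasDerivAt_jet hu.1 x).deriv,
      totalDeriv_rayInt ((hQ.coeff_zero a b).primitive N).smooth contDiff_one_sub]
    unfold rayInt
    refine integral_congr fun t _ => ?_
    simp only
    -- The primitive exists because the integral of this coefficient is a bracket of Casimirs.
    rw [← jet_smul, totalDeriv_primitive hD (hQ.coeff_zero a b) hN (fun v hv => ?_) (hu.smul t)]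
    rw [← casimirBracket_eq_integral]
    exact casimirBracket_eq_zero hg hreg hD hQ hc b a hv
  have e1 : pairing (VField.val (compensator g Q N) (hydroOp g w)) (dCasimir b)
      = ∫ x in (0 : ℝ)..1, -∑ a, deriv (fun x => w x a) x * h a (jet (hydroOp g w) x) := by
    simp only [pairing, VField.val, compensator, inv_mulVec_jet_hydroOp hreg hw, zero_add,
      jet_one_eq_deriv hw.1, h]
    simp [dCasimir, Pi.single_apply]
  rw [e1, intervalIntegral.integral_neg, intervalIntegral.integral_finsetSum fun a _ =>
    ((hw.scalar a).deriv.mul (hl a)).continuous.intervalIntegrable _ _, ← Finset.sum_neg_distrib]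
  simp only [(hw.scalar _).integral_deriv_mul (hl _), neg_neg, hder]
  unfold pairing
  rw [intervalIntegral.integral_finsetSum fun a _ => ?_]
  · refine Finset.sum_congr rfl fun a _ => integral_congr fun x _ => ?_
    simp only [DiffOp.act_dCasimir]
    rw [mul_comm]
    rfl
  · exact ((((hQ.rayInt contDiff_one_sub).isLoop_act hu (isLoop_dCasimir b)).scalar a).mul
      (hw.scalar a)).continuous.intervalIntegrable _ _

/-- Differentiating `∫ (1 - t) ⟨Q_{tu} e_b, w⟩ dt` and using closedness, the derivative of `Q`
appears with weight `p = t (1 - t)`. As `p` vanishes at both ends, integration by parts in `t`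
changes the total weight of `⟨Q_{tu} e_b, β⟩` to `(1 - t) - p' = t`. -/
theorem pairing_frechet_compensator (hg : g.IsSymm) (hreg : IsUnit g.det) (hD : 0 < D)
    (hN : D < N) (hQ : Q.HomCoeff D) (hc : IsCocycle (hydro g) Q) (hw : IsLoop w)
    (hβ : IsLoop β) (b : Fin n) :
    pairing (VField.frechet (compensator g Q N) (hydroOp g w) (hydroOp g β)) (dCasimir b)
      = pairing ((Q.rayInt fun t => t).act (hydroOp g w) (dCasimir b)) β := by
  have hu := isLoop_hydroOp g hw
  have hv := isLoop_hydroOp g hβ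
  have hb := isLoop_dCasimir b
  have hQ' := hQ.rayInt contDiff_one_sub
  have h1 := VField.hasDerivAt_pairing_val (fun a => homLocal_compensator (g := g) (N := N) hQ a)
    hu hv hb
  have h2 : HasDerivAt (fun s : ℝ => pairing (VField.val (compensator g Q N)
      (hydroOp g w + s • hydroOp g β)) (dCasimir b))
      (pairing ((Q.rayInt fun t => 1 - t).frechet (hydroOp g w) (dCasimir b) (hydroOp g β)) w
        + pairing ((Q.rayInt fun t => 1 - t).act (hydroOp g w) (dCasimir b)) β) 0 := by
    have e : (fun s : ℝ => pairing (VField.val (compensator g Q N)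
        (hydroOp g w + s • hydroOp g β)) (dCasimir b)) = fun s : ℝ =>
        pairing ((Q.rayInt fun t => 1 - t).act (hydroOp g w + s • hydroOp g β) (dCasimir b)) w
        + s * pairing ((Q.rayInt fun t => 1 - t).act (hydroOp g w + s • hydroOp g β)
          (dCasimir b)) β := by
      funext s
      have hl := hQ'.isLoop_act (hu.add (hv.smul s)) hb
      rw [← hydroOp_add_smul g hw hβ, pairing_compensator hg hreg hD hN hQ hc
        (hw.add (hβ.smul s)), pairing_comm, hydroOp_add_smul g hw hβ,
        pairing_add_left hw (hβ.smul s) hl, pairing_smul_left, pairing_comm w, pairing_comm β]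
    have hz : (fun _ : ℝ => (0 : Fin n → ℝ)) = 0 := rfl
    have key : ∀ γ, IsLoop γ → HasDerivAt (fun s : ℝ => pairing ((Q.rayInt fun t => 1 - t).act
        (hydroOp g w + s • hydroOp g β) (dCasimir b)) γ)
        (pairing ((Q.rayInt fun t => 1 - t).frechet (hydroOp g w) (dCasimir b) (hydroOp g β)) γ)
        0 := by
      intro γ hγ
      have h := hQ'.hasDerivAt_pairing_act hu hv hb (IsLoop.const 0) hγ 0
      simpa only [hz, smul_zero, zero_smul, add_zero, DiffOp.act_zero, pairing_zero_left] using h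
    rw [e]
    refine ((key w hw).add ((hasDerivAt_id (0 : ℝ)).mul (key β hβ))).congr_deriv ?_
    simp
  rw [h1.unique h2, hQ.pairing_rayInt_frechet contDiff_one_sub hu hb hv hw,
    hQ.pairing_rayInt_act contDiff_one_sub.continuous hu hb hβ,
    hQ.pairing_rayInt_act continuous_id' hu hb hβ]
  have hcyc : ∀ t : ℝ, pairing (Q.frechet (t • hydroOp g w) (dCasimir b) (hydroOp g β)) w
      = pairing (Q.frechet (t • hydroOp g w) (dCasimir b) (hydroOp g w)) β := fun t =>
    pairing_frechet_dCasimir hg hQ hc (hu.smul t) hβ hw b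
  simp only [hcyc]
  have hftc := hQ.integral_deriv_mul_pairing hu hb hβ (p := fun t => (1 - t) * t)
    (p' := fun t => (1 - t) - t) (fun t => by
      refine (((hasDerivAt_id t).const_sub 1).mul (hasDerivAt_id t)).congr_deriv ?_
      simp only [id]; ring) (by fun_prop)
  have c1 := (hQ.contDiff_pairing_act_ray hu hb hβ).continuous
  have c2 := hQ.continuous_pairing_frechet_ray hu hb hu hβ
  rw [← intervalIntegral.integral_add, ← sub_eq_zero, ← intervalIntegral.integral_sub]
  · simp only [sub_self, zero_mul, mul_zero] at hftc
    refine Eq.trans (integral_congr fun t _ => ?_) hftc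
    ring
  all_goals exact Continuous.intervalIntegrable (by fun_prop) _ _

/-- Dual form of the differential of `∫ f_b dx`. It identifies the coefficient of the
undifferentiated `w^b` in the differential of `G`. -/
theorem hydroOp_adj_compensator (hg : g.IsSymm) (hreg : IsUnit g.det) (hD : 0 < D)
    (hN : D < N) (hQ : Q.HomCoeff D) (hc : IsCocycle (hydro g) Q) (hw : IsLoop w) (b : Fin n) :
    hydroOp g (adj (VField.frechet (compensator g Q N) (hydroOp g w)) (dCasimir b))
      = (-1 : ℝ) • (Q.rayInt fun t => t).act (hydroOp g w) (dCasimir b) := by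
  have hu := isLoop_hydroOp g hw
  have hb := isLoop_dCasimir b
  have ha := VField.isAdjointValue_frechet (N := D.toNat)
    (fun a => homLocal_compensator (g := g) (N := N) hQ a) hu hb (by omega)
  rw [← ha.adj_eq] at ha
  refine eq_of_pairing_eq (isLoop_hydroOp g ha.1)
    (((hQ.rayInt (contDiff_id : ContDiff ℝ ∞ fun t : ℝ => t)).isLoop_act hu hb).smul _) fun β hβ => ?_
  rw [pairing_hydroOp hg ha.1 hβ, pairing_comm, ← ha.2 _ (isLoop_hydroOp g hβ),
    pairing_frechet_compensator hg hreg hD hN hQ hc hw hβ, pairing_smul_left]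
  ring

end compensator

/-! ### The potential -/

theorem hydroOp_greenAdj (g : Matrix (Fin n) (Fin n) ℝ) {N : ℕ} {p : ℕ → Fin n → ℝ → ℝ}
    (hp : ∀ i c, IsScalarLoop (p i c)) (x : ℝ) (a : Fin n) :
    hydroOp g (greenAdj N p) x a
      = ∑ c, g a c * ∑ i ∈ Finset.range N, (-1) ^ i * iteratedDeriv (i + 1) (p i c) x := by
  refine Finset.sum_congr rfl fun c _ => ?_
  rw [jet_one_eq_deriv (isLoop_greenAdj hp).1]
  congr 1
  refine HasDerivAt.deriv (HasDerivAt.fun_sum fun i _ => ?_)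
  rw [iteratedDeriv_succ]
  exact (((hp i c).iteratedDeriv i).hasDerivAt x).const_mul _

/-- The part without `w` of the `i`-th total derivative of `p(u) w_b`, where `u = g w_x`. -/
def remainder (g : Matrix (Fin n) (Fin n) ℝ) (b : Fin n) : ℕ → (Jet n → ℝ) → Jet n → ℝ
  | 0, _ => fun _ => 0
  | i + 1, p => fun j =>
      totalDeriv (remainder g b i p) j + totalDeriv^[i] p j * g⁻¹.mulVec (j 0) b

theorem HomLocal.remainder {d : ℤ} {p : Jet n → ℝ} (hp : HomLocal d p)
    (g : Matrix (Fin n) (Fin n) ℝ) (b : Fin n) (i : ℕ) :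
    HomLocal (d + i - 1) (remainder g b i p) := by
  induction i with
  | zero => exact HomLocal.zero _
  | succ i ih =>
    exact (ih.totalDeriv.congr_degree (by push_cast; ring)).add
      (((hp.iterate_totalDeriv i).mul (HomLocal.invCoord g 0 b)).congr_degree
        (by push_cast; ring))

/-- Leibniz rule: once a derivative falls on `w_b` it yields `g⁻¹ u`, which is local in `u`, so `w`
survives undifferentiated in a single term. -/
theorem iteratedDeriv_mul_coord {g : Matrix (Fin n) (Fin n) ℝ} (hreg : IsUnit g.det) {d : ℤ}
    {p : Jet n → ℝ} (hp : HomLocal d p) {w : ℝ → Fin n → ℝ} (hw : IsLoop w) (b : Fin n) (i : ℕ) :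
    iteratedDeriv i (fun x => p (jet (hydroOp g w) x) * w x b) = fun x =>
      totalDeriv^[i] p (jet (hydroOp g w) x) * w x b
        + remainder g b i p (jet (hydroOp g w) x) := by
  have hu := isLoop_hydroOp g hw
  induction i with
  | zero => simp [remainder]
  | succ i ih =>
    rw [iteratedDeriv_succ, ih]
    funext x
    have h1 := (hp.iterate_totalDeriv i).smooth.hasDerivAt_jet hu.1 x
    have h2 := (hp.remainder g b i).smooth.hasDerivAt_jet hu.1 x
    refine ((h1.mul ((hw.scalar b).hasDerivAt x)).add h2).deriv.trans ?_
    rw [Function.iterate_succ_apply', remainder]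
    simp only
    rw [inv_mulVec_jet_hydroOp hreg hw, zero_add, jet_one_eq_deriv hw.1]
    ring

/-- The vector field `X` with `L_X (g d/dx) = Q`. -/
def potential (g : Matrix (Fin n) (Fin n) ℝ) (Q : DiffOp n) (N : ℕ) : VField n := fun a j =>
  compensator g Q N a j
    - ∑ m ∈ Finset.range Q.order, ∑ b,
        rayInt (fun t => t) (Q.coeff (m + 1) a b) j * g⁻¹.mulVec (j m) b
    - ∑ c, g a c * ∑ i ∈ Finset.range N, (-1) ^ i *
        ∑ b, remainder g b (i + 1) (part (compensator g Q N b) i c) j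

section potential

variable {g : Matrix (Fin n) (Fin n) ℝ} {Q : DiffOp n} {D : ℤ} {N : ℕ}
  {w α β : ℝ → Fin n → ℝ}

theorem homLocal_potential (hQ : Q.HomCoeff D) (a : Fin n) :
    HomLocal (D - 1) (potential g Q N a) := by
  refine ((homLocal_compensator hQ a).sub ?_).sub ?_
  · refine HomLocal.sum fun m hm => HomLocal.sum fun b _ => ?_
    have hm' : m + 1 ∈ Finset.range (Q.order + 1) := by simpa using hm
    exact (((hQ (m + 1) hm' a b).rayInt contDiff_id).mul (HomLocal.invCoord g m b)).congr_degree
      (by push_cast; ring)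
  · exact HomLocal.sum fun c _ => (HomLocal.sum fun i _ => (HomLocal.sum fun b _ =>
      (((homLocal_compensator hQ b).part i c).remainder g b (i + 1)).congr_degree
        (by push_cast; ring)).const_mul _).const_mul _

theorem isScalarLoop_sum_part {X : VField n} {d : ℤ} (hX : ∀ a, HomLocal d (X a))
    {u : ℝ → Fin n → ℝ} (hu : IsLoop u) (hβ : IsLoop β) (i : ℕ) (c : Fin n) :
    IsScalarLoop fun x => ∑ a, part (X a) i c (jet u x) * β x a :=
  IsScalarLoop.sum fun a _ => (((hX a).smooth.part i c).isScalarLoop hu).mul (hβ.scalar a)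

theorem hydroOp_adj_frechet {X : VField n} {d : ℤ} (hX : ∀ a, HomLocal d (X a))
    {u : ℝ → Fin n → ℝ} (hu : IsLoop u) (hβ : IsLoop β) (hN : d < N) (x : ℝ) (a : Fin n) :
    hydroOp g (adj (VField.frechet X u) β) x a = ∑ c, g a c * ∑ i ∈ Finset.range N,
      (-1) ^ i * iteratedDeriv (i + 1) (fun x => ∑ b, part (X b) i c (jet u x) * β x b) x := by
  rw [(VField.isAdjointValue_frechet hX hu hβ hN).adj_eq]
  exact hydroOp_greenAdj g (isScalarLoop_sum_part hX hu hβ) x a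

/-- The right-hand side is `dG - θ`, where `dG(β) = ⟨f, β⟩ + ⟨f'(Pβ), w⟩` and `P` is skew. Its terms
in undifferentiated `w` cancel, which is why `potential` can be given by an expression in `u` alone.
-/
theorem val_potential (hg : g.IsSymm) (hreg : IsUnit g.det) (hD : 0 < D) (hN : D < N)
    (hQ : Q.HomCoeff D) (hc : IsCocycle (hydro g) Q) (hw : IsLoop w) :
    VField.val (potential g Q N) (hydroOp g w)
      = VField.val (compensator g Q N) (hydroOp g w) - (Q.rayInt fun t => t).act (hydroOp g w) w
        - hydroOp g (adj (VField.frechet (compensator g Q N) (hydroOp g w)) w) := by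
  have hu := isLoop_hydroOp g hw
  have hf : ∀ b, HomLocal (D - 1) (compensator g Q N b) := fun b => homLocal_compensator hQ b
  have hN' : D - 1 < N := by omega
  funext x a
  set j := jet (hydroOp g w) x with hj
  -- The coefficient of undifferentiated `w^b` in `P f'* w` is found by applying the operator `P
  -- f'*` to the constant `e_b`.
  have hconst : ∀ b, ∑ c, g a c * ∑ i ∈ Finset.range N,
      (-1) ^ i * totalDeriv^[i + 1] (part (compensator g Q N b) i c) j
        = -rayInt (fun t => t) (Q.coeff 0 a b) j := by
    intro b
    have h := congrFun (congrFun (hydroOp_adj_compensator hg hreg hD hN hQ hc hw b) x) a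
    rw [hydroOp_adj_frechet hf hu (isLoop_dCasimir b) hN'] at h
    simp only [Pi.smul_apply, DiffOp.act_dCasimir, smul_eq_mul] at h
    have e : ∀ i c, iteratedDeriv (i + 1) (fun x => ∑ b', part (compensator g Q N b') i c
        (jet (hydroOp g w) x) * dCasimir b x b') x
        = totalDeriv^[i + 1] (part (compensator g Q N b) i c) j := by
      intro i c
      have e' : (fun x => ∑ b', part (compensator g Q N b') i c
          (jet (hydroOp g w) x) * dCasimir b x b')
          = fun x => part (compensator g Q N b) i c (jet (hydroOp g w) x) := by
        funext x
        simp [dCasimir, Pi.single_apply]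
      rw [e', ((hf b).smooth.part i c).iteratedDeriv_jet hu.1]
    simp only [e] at h
    rw [h, neg_one_mul]
    rfl
  have hadj : hydroOp g (adj (VField.frechet (compensator g Q N) (hydroOp g w)) w) x a
      = ∑ b, -rayInt (fun t => t) (Q.coeff 0 a b) j * w x b
        + ∑ c, g a c * ∑ i ∈ Finset.range N, (-1) ^ i *
          ∑ b, remainder g b (i + 1) (part (compensator g Q N b) i c) j := by
    rw [hydroOp_adj_frechet hf hu hw hN']
    have e : ∀ i c, iteratedDeriv (i + 1) (fun x => ∑ b, part (compensator g Q N b) i c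
        (jet (hydroOp g w) x) * w x b) x
        = ∑ b, totalDeriv^[i + 1] (part (compensator g Q N b) i c) j * w x b
          + ∑ b, remainder g b (i + 1) (part (compensator g Q N b) i c) j := by
      intro i c
      have hi : (((i + 1 : ℕ) : ℕ∞ω)) ≤ ∞ := by exact_mod_cast le_top
      rw [iteratedDeriv_fun_sum fun b _ => (((((hf b).smooth.part i c).isScalarLoop hu).mul
        (hw.scalar b)).1.of_le hi).contDiffAt, ← Finset.sum_add_distrib]
      exact Finset.sum_congr rfl fun b _ =>
        congrFun (iteratedDeriv_mul_coord hreg ((hf b).part i c) hw b (i + 1)) x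
    simp only [e, mul_add, Finset.sum_add_distrib, ← hconst]
    congr 1
    simp only [Finset.sum_mul, Finset.mul_sum]
    rw [Finset.sum_congr rfl fun c _ => Finset.sum_comm, Finset.sum_comm]
    refine Finset.sum_congr rfl fun b _ => Finset.sum_congr rfl fun c _ =>
      Finset.sum_congr rfl fun i _ => ?_
    ring
  have hact : (Q.rayInt fun t => t).act (hydroOp g w) w x a
      = ∑ m ∈ Finset.range Q.order, ∑ b,
          rayInt (fun t => t) (Q.coeff (m + 1) a b) j * jet w x (m + 1) b
        + ∑ b, rayInt (fun t => t) (Q.coeff 0 a b) j * w x b := by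
    rw [DiffOp.act, Finset.sum_range_succ']
    simp only [iteratedDeriv_zero]
    rfl
  simp only [Pi.sub_apply, hadj, hact, VField.val, potential, hj, inv_mulVec_jet_hydroOp hreg hw,
    neg_mul, Finset.sum_neg_distrib]
  ring

/-- The pairing of the potential with a one-form, differentiated along the image of `g d/dx`. -/
theorem pairing_frechet_potential (hg : g.IsSymm) (hreg : IsUnit g.det) (hD : 0 < D) (hN : D < N)
    (hQ : Q.HomCoeff D) (hc : IsCocycle (hydro g) Q) (hw : IsLoop w) (hα : IsLoop α)
    (hβ : IsLoop β) :
    pairing (VField.frechet (potential g Q N) (hydroOp g w) (hydroOp g α)) β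
      = pairing (VField.frechet (compensator g Q N) (hydroOp g w) (hydroOp g α)) β
        - (pairing ((Q.rayInt fun t => t).frechet (hydroOp g w) w (hydroOp g α)) β
            + pairing ((Q.rayInt fun t => t).act (hydroOp g w) α) β)
        + ((∫ x in (0 : ℝ)..1, ∑ a,
            dir (fun j => dir (compensator g Q N a) j (jet (hydroOp g β) x))
              (jet (hydroOp g w) x) (jet (hydroOp g α) x) * w x a)
            + pairing (VField.frechet (compensator g Q N) (hydroOp g w) (hydroOp g β)) α) := by
  have hu := isLoop_hydroOp g hw
  have hv := isLoop_hydroOp g hα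
  have hf : ∀ b, HomLocal (D - 1) (compensator g Q N b) := fun b => homLocal_compensator hQ b
  have hQ' : (Q.rayInt fun t => t).HomCoeff D := hQ.rayInt contDiff_id
  have h1 := VField.hasDerivAt_pairing_val (fun a => homLocal_potential (g := g) (N := N) hQ a)
    hu hv hβ
  -- Along the line `w + s α`, the first and third terms form `dG(β)` and the second is `θ(β)`.
  have e : (fun s : ℝ => pairing (VField.val (potential g Q N) (hydroOp g w + s • hydroOp g α)) β)
      = fun s : ℝ => pairing (VField.val (compensator g Q N) (hydroOp g w + s • hydroOp g α)) β
        - pairing ((Q.rayInt fun t => t).act (hydroOp g w + s • hydroOp g α) (w + s • α)) β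
        + pairing (VField.frechet (compensator g Q N) (hydroOp g w + s • hydroOp g α)
            (hydroOp g β)) (w + s • α) := by
    funext s
    have hws := hw.add (hα.smul s)
    have hus := isLoop_hydroOp g hws
    have ha := VField.isAdjointValue_frechet (N := N) hf hus hws (by omega)
    rw [← ha.adj_eq] at ha
    rw [← hydroOp_add_smul g hw hα, val_potential hg hreg hD hN hQ hc hws,
      pairing_sub_left ((VField.isLoop_val hf hus).sub (hQ'.isLoop_act hus hws))
        (isLoop_hydroOp g ha.1) hβ,
      pairing_sub_left (VField.isLoop_val hf hus) (hQ'.isLoop_act hus hws) hβ,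
      pairing_hydroOp hg ha.1 hβ, pairing_comm (adj _ _), ← ha.2 _ (isLoop_hydroOp g hβ)]
    ring
  rw [e] at h1
  have h2 := VField.hasDerivAt_pairing_val hf hu hv hβ
  have h3 := hQ'.hasDerivAt_pairing_act hu hv hw hα hβ 0
  have h4 := VField.hasDerivAt_pairing_frechet hf hu hv (isLoop_hydroOp g hβ) hw hα
  simp only [zero_smul, add_zero] at h3
  exact h1.unique ((h2.sub h3).add h4)

/-- The Poincaré lemma for the 2-form of `Q`. The contribution of `G` is symmetric in `α` and `β`
and drops out; the rest is the integral of the derivative of `t² ⟨Q_{tu} α, β⟩`. -/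
theorem pairing_frechet_potential_sub (hg : g.IsSymm) (hreg : IsUnit g.det) (hD : 0 < D)
    (hN : D < N) (hQ : Q.HomCoeff D) (hskew : Q.IsSkew) (hc : IsCocycle (hydro g) Q)
    (hw : IsLoop w) (hα : IsLoop α) (hβ : IsLoop β) :
    pairing (VField.frechet (potential g Q N) (hydroOp g w) (hydroOp g β)) α
        - pairing (VField.frechet (potential g Q N) (hydroOp g w) (hydroOp g α)) β
      = pairing (Q.act (hydroOp g w) α) β := by
  have hu := isLoop_hydroOp g hw
  have hsym : ∀ x, ∑ a, dir (fun j => dir (compensator g Q N a) j (jet (hydroOp g β) x))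
        (jet (hydroOp g w) x) (jet (hydroOp g α) x) * w x a
      = ∑ a, dir (fun j => dir (compensator g Q N a) j (jet (hydroOp g α) x))
        (jet (hydroOp g w) x) (jet (hydroOp g β) x) * w x a := fun x =>
    Finset.sum_congr rfl fun a _ => by
      rw [(homLocal_compensator hQ a).smooth.dir_dir_comm]
  have hA := pairing_frechet_potential (N := N) hg hreg hD hN hQ hc hw hα hβ
  have hB := pairing_frechet_potential (N := N) hg hreg hD hN hQ hc hw hβ hα
  simp only [hsym] at hA
  have id' : ContDiff ℝ ∞ fun t : ℝ => t := contDiff_id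
  rw [hQ.pairing_rayInt_frechet id' hu hw (isLoop_hydroOp g hα) hβ,
    hQ.pairing_rayInt_act id'.continuous hu hα hβ] at hA
  rw [hQ.pairing_rayInt_frechet id' hu hw (isLoop_hydroOp g hβ) hα,
    hQ.pairing_rayInt_act id'.continuous hu hβ hα] at hB
  have hsk : ∀ t : ℝ, pairing (Q.act (t • hydroOp g w) β) α
      = -pairing (Q.act (t • hydroOp g w) α) β := fun t => by
    rw [hskew _ β α (hu.smul t) hβ hα, pairing_comm]
  -- Closedness at `t u`, with the radial vector `w` among the arguments, for which `P w = u`.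
  have hco : ∀ t : ℝ, pairing (Q.frechet (t • hydroOp g w) w (hydroOp g β)) α
      = pairing (Q.frechet (t • hydroOp g w) w (hydroOp g α)) β
        - pairing (Q.frechet (t • hydroOp g w) α (hydroOp g w)) β := fun t => by
    have := hc.pairing_eq hg hQ (hu.smul t) hw hα hβ
    linarith
  simp only [hsk, hco] at hB
  have hftc := hQ.integral_deriv_mul_pairing hu hα hβ (p := fun t => t * t)
    (p' := fun t => t + t) (fun t => by
      refine ((hasDerivAt_id t).mul (hasDerivAt_id t)).congr_deriv ?_
      simp) (by fun_prop)
  have c1 := (hQ.contDiff_pairing_act_ray hu hα hβ).continuous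
  have c2 := hQ.continuous_pairing_frechet_ray hu hα hu hβ
  have c3 := hQ.continuous_pairing_frechet_ray hu hw (isLoop_hydroOp g hα) hβ
  have i1 : IntervalIntegrable (fun t : ℝ => t * pairing (Q.act (t • hydroOp g w) α) β)
      volume 0 1 := Continuous.intervalIntegrable (by fun_prop) _ _
  have i2 : IntervalIntegrable (fun t : ℝ => t * t *
      pairing (Q.frechet (t • hydroOp g w) α (hydroOp g w)) β) volume 0 1 :=
    Continuous.intervalIntegrable (by fun_prop) _ _
  have i3 : IntervalIntegrable (fun t : ℝ => t * t *
      pairing (Q.frechet (t • hydroOp g w) w (hydroOp g α)) β) volume 0 1 :=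
    Continuous.intervalIntegrable (by fun_prop) _ _
  simp only [add_mul, one_mul, mul_zero, zero_mul, sub_zero] at hftc
  rw [intervalIntegral.integral_add (i1.add i1) i2, intervalIntegral.integral_add i1 i1] at hftc
  simp only [mul_sub, mul_neg, intervalIntegral.integral_neg,
    intervalIntegral.integral_sub i3 i2] at hB
  linarith

theorem act_eq_lieDeriv_hydroOp (hg : g.IsSymm) (hreg : IsUnit g.det) (hD : 0 < D)
    (hN : D < N) (hQ : Q.HomCoeff D) (hskew : Q.IsSkew) (hc : IsCocycle (hydro g) Q)
    (hw : IsLoop w) (hα : IsLoop α) :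
    Q.act (hydroOp g w) α = lieDeriv (potential g Q N) (hydro g) (hydroOp g w) α := by
  have hu := isLoop_hydroOp g hw
  have hX : ∀ a, HomLocal (D - 1) (potential g Q N a) := fun a => homLocal_potential hQ a
  have ha := VField.isAdjointValue_frechet (N := N) hX hu hα (by omega)
  rw [← ha.adj_eq] at ha
  have hl1 := VField.isLoop_frechet hX hu (isLoop_hydroOp g hα)
  have hl2 := isLoop_hydroOp g ha.1
  rw [lieDeriv, hydro_frechet, hydro_act, hydro_act, zero_sub]
  have e : -VField.frechet (potential g Q N) (hydroOp g w) (hydroOp g α)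
      = (-1 : ℝ) • VField.frechet (potential g Q N) (hydroOp g w) (hydroOp g α) := by simp
  rw [e]
  refine eq_of_pairing_eq (hQ.isLoop_act hu hα) ((hl1.smul _).sub hl2) fun β hβ => ?_
  rw [pairing_sub_left (hl1.smul _) hl2 hβ, pairing_smul_left, pairing_hydroOp hg ha.1 hβ,
    pairing_comm (adj _ _), ← ha.2 _ (isLoop_hydroOp g hβ),
    ← pairing_frechet_potential_sub hg hreg hD hN hQ hskew hc hw hα hβ]
  ring

/-- The Lie derivative of `g d/dx` at `u` depends only on the germ of `u`. -/
theorem lieDeriv_hydro_congr {X : VField n} {d : ℤ} (hX : ∀ a, HomLocal d (X a))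
    {u v : ℝ → Fin n → ℝ} (hu : IsLoop u) (hv : IsLoop v) (hα : IsLoop α) {x : ℝ}
    (h : u =ᶠ[𝓝 x] v) : lieDeriv X (hydro g) u α x = lieDeriv X (hydro g) v α x := by
  have hj : ∀ᶠ y in 𝓝 x, jet u y = jet v y := by
    filter_upwards [h.eventuallyEq_nhds] with y hy
    exact funext fun i => hy.iteratedDeriv_eq i
  funext a
  simp only [lieDeriv, hydro_frechet, hydro_act, Pi.sub_apply]
  rw [VField.frechet_apply hX hu (isLoop_hydroOp g hα),
    VField.frechet_apply hX hv (isLoop_hydroOp g hα), hj.self_of_nhds,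
    hydroOp_adj_frechet (N := d.toNat + 1) hX hu hα (by omega),
    hydroOp_adj_frechet (N := d.toNat + 1) hX hv hα (by omega)]
  congr 1
  refine Finset.sum_congr rfl fun c _ => ?_
  congr 1
  refine Finset.sum_congr rfl fun i _ => ?_
  congr 1
  refine Filter.EventuallyEq.iteratedDeriv_eq (i + 1) ?_
  filter_upwards [hj] with y hy
  rw [hy]

/-- Loops of nonzero mean are not in the image of `g d/dx`. Near any given `x`, however, `u` agrees
with a loop in the image, and both sides at `x` depend only on the germ of `u`. -/
theorem isPotential_potential (hg : g.IsSymm) (hreg : IsUnit g.det) (hD : 0 < D)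
    (hN : D < N) (hQ : Q.HomCoeff D) (hskew : Q.IsSkew) (hc : IsCocycle (hydro g) Q) :
    IsPotential (hydro g) Q (potential g Q N) := by
  intro u α hu hα
  funext x
  obtain ⟨w, hw, hwu⟩ := exists_hydroOp_eventuallyEq hreg hu x
  have hj : jet (hydroOp g w) x = jet u x := funext fun i => hwu.iteratedDeriv_eq i
  rw [← lieDeriv_hydro_congr (fun a => homLocal_potential hQ a) (isLoop_hydroOp g hw) hu hα hwu,
    ← act_eq_lieDeriv_hydroOp hg hreg hD hN hQ hskew hc hw hα]
  funext a
  simp only [DiffOp.act, hj]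

end potential

end HydroPoisson

end

theorem mainTheorem2 (n : ℕ) (g : Matrix (Fin n) (Fin n) ℝ) (hsymm : g.IsSymm)
    (hreg : IsUnit g.det) (k : ℕ) (Q : HydroPoisson.DiffOp n)
    (hhom : Q.IsHomogeneous (k + 1)) (hskew : Q.IsSkew)
    (hcocycle : HydroPoisson.IsCocycle (HydroPoisson.hydro g) Q) :
    (∀ (a b : Fin n) (u : ℝ → Fin n → ℝ), HydroPoisson.IsLoop u →
      HydroPoisson.casimirBracket Q a b u = 0) ∧
    ∃ X : HydroPoisson.VField n,
      (∀ a, HydroPoisson.IsHomDiffPoly k (X a)) ∧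
      HydroPoisson.IsPotential (HydroPoisson.hydro g) Q X := by
  have hQ := hhom.homCoeff
  have hD : (0 : ℤ) < ((k + 1 : ℕ) : ℤ) := by positivity
  refine ⟨fun a b u hu =>
    HydroPoisson.casimirBracket_eq_zero hsymm hreg hD hQ hcocycle a b hu,
    -- The degree is `D = k + 1`, and `k + 2` terms include every order of jet coordinate on which
    -- the coefficients can depend.
    HydroPoisson.potential g Q (k + 2), fun a => ?_,
    HydroPoisson.isPotential_potential hsymm hreg hD (by push_cast; omega) hQ hskew hcocycle⟩
  exact ((HydroPoisson.homLocal_potential hQ a).congr_degree (by push_cast; ring)).isHomDiffPoly
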